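/- **Setting.** A *graded domain* is a commutative integral domain $R$ with a $\mathbb Z\times\mathbb Z$-grading $\operatorname{gr}=(\operatorname{gr}_1,\operatorname{gr}_2)$ such that $\operatorname{gr}_1\equiv\operatorname{gr}_2 \bmod 2$ on nonzero homogeneous elements, and such that either all degrees of nonzero homogeneous elements lie in $2\mathbb Z\times 2\mathbb Z$ or $-1=1$ in $R$. It is a *graded valuation ring* if its homogeneous elements are totally ordered by divisibility (up to units), and it is *type-zero* if its degree-$(0,0)$ piece consists precisely of $0$ and the units of $R$. Let $\mathcal R_U$, $\mathcal R_V$ be type-zero graded valuation rings with quotient maps $f\colon\mathcal R_U\to\mathbb K$, $g\colon\mathcal R_V\to\mathbb K$ onto a common residue field, whose kernels $\mathfrak m_U,\mathfrak m_V$ are the sums of all pieces of degree $\ne(0,0)$. The associated *grid ring* is $\mathcal S=\{(a,b)\in\mathcal R_U\times\mathcal R_V: f(a)=g(b)\}$, with degree-$n$ piece $\{(a,b)\in\mathcal S: a\in\mathcal R_U^{n},\, b\in\mathcal R_V^{n}\}$; $\mathcal R_U$ and $\mathcal R_V$ are $\mathcal S$-algebras by projection. An *$\mathcal S$-complex* is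 a free, finitely generated, $\mathbb Z\times\mathbb Z$-graded $\mathcal S$-module $C$ with $\operatorname{gr}_1\equiv\operatorname{gr}_2\bmod 2$ on nonzero homogeneous elements and an $\mathcal S$-linear differential $\partial$ of degree $(-1,-1)$ with $\partial^2=0$. It is *knotlike* if * it is reduced: $\partial C\subseteq(\mathfrak m_U,\mathfrak m_V)\,C$; * $H_*(C\otimes_{\mathcal S}\mathcal R_U)/\mathcal R_U\text{-torsion}\cong\mathcal R_U$ by an $\mathcal R_U$-linear isomorphism that preserves $\operatorname{gr}_2$ and is homogeneous (of some degree) with respect to $\operatorname{gr}_1$; * $H_*(C\otimes_{\mathcal S}\mathcal R_V)/\mathcal R_V\text{-torsion}\cong\mathcal R_V$ by an $\mathcal R_V$-linear isomorphism that preserves $\operatorname{gr}_1$ and is homogeneous with respect to $\operatorname{gr}_2$. A *local map* $C_1\to C_2$ is an $\mathcal S$-linear chain map that preserves $\operatorname{gr}_1$, is homogeneous with respect to $\operatorname{gr}_2$, and induces an isomorphism on $H_*(\,\cdot\,\otimes_{\mathcal S}\mathcal R_V)/\mathcal R_V$-torsion. Write $C_1\le C_2$ if there is a local map $C_1\to C_2$,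 call $C_1,C_2$ *locally equivalent* if $C_1\le C_2$ and $C_2\le C_1$, and let $\mathfrak K$ be the set of local equivalence classes of knotlike complexes. The product of two complexes is $C_1\otimes_{\mathcal S}C_2$ with $\partial(a\otimes b)=\partial a\otimes b+(-1)^{\operatorname{gr}_1(a)}a\otimes\partial b$ for $a$ homogeneous. **Theorem.** Let $\mathcal S$ be a grid ring. 1. The product of two knotlike complexes is knotlike, and $\otimes_{\mathcal S}$ makes $\mathfrak K$ an abelian group whose identity is the class of the trivial complex $\mathcal S$ (with zero differential). The relation $\le$ is a total order on $\mathfrak K$ compatible with the group structure: if $a\le b$ then $ac\le bc$ for all $a,b,c\in\mathfrak K$. 2. Let $C$ be a knotlike complex. If there is no local map $\mathcal S\to C$, then there is a local map $C\to\mathcal S$. -/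

import Mathlib

open scoped TensorProduct

universe u

/-! ### Graded valuation rings -/

/-- A graded domain: an integral domain with a `ℤ × ℤ`-grading `gr = (gr₁, gr₂)` such that
`gr₁ ≡ gr₂ mod 2` on nonzero homogeneous elements and either all degrees are in `2ℤ × 2ℤ`
or `-1 = 1`. -/
structure IsGradedDomain {R : Type u} [CommRing R] (𝒜 : ℤ × ℤ → AddSubgroup R)
    [GradedRing 𝒜] : Prop where
  isDomain : IsDomain R
  parity : ∀ n : ℤ × ℤ, 𝒜 n ≠ ⊥ → n.1 ≡ n.2 [ZMOD 2]
  even_or_neg_one : (∀ n : ℤ × ℤ, 𝒜 n ≠ ⊥ → Even n.1 ∧ Even n.2) ∨ (-1 : R) = 1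

/-- A graded valuation ring: a graded domain whose homogeneous elements are totally
ordered by divisibility (up to units). -/
structure IsGradedValuationRing {R : Type u} [CommRing R] (𝒜 : ℤ × ℤ → AddSubgroup R)
    [GradedRing 𝒜] : Prop extends IsGradedDomain 𝒜 where
  dvd_total : ∀ x y : R, SetLike.IsHomogeneousElem 𝒜 x → SetLike.IsHomogeneousElem 𝒜 y →
    x ∣ y ∨ y ∣ x

/-- A graded valuation ring is type-zero if its degree-`(0,0)` piece consists precisely of
the invertible elements together with zero. -/
structure IsTypeZero {R : Type u} [CommRing R] (𝒜 : ℤ × ℤ → AddSubgroup R)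
    [GradedRing 𝒜] : Prop extends IsGradedValuationRing 𝒜 where
  mem_zero_iff : ∀ x : R, x ∈ 𝒜 0 ↔ x = 0 ∨ IsUnit x

/-! ### Grid rings -/

/-- The data from which a grid ring is built: two type-zero graded valuation rings `RU`, `RV`
and quotient maps `fU`, `fV` onto a common residue field `K`. The kernel of `fU` is the
maximal homogeneous ideal of `RU`, the sum of all pieces of degree different from `(0,0)`;
similarly for `fV`. -/
structure GridDatum where
  K : Type u
  RU : Type u
  RV : Type u
  [fieldK : Field K]
  [ringU : CommRing RU]
  [ringV : CommRing RV]
  grU : ℤ × ℤ → AddSubgroup RU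
  grV : ℤ × ℤ → AddSubgroup RV
  [gradedU : GradedRing grU]
  [gradedV : GradedRing grV]
  typeZeroU : IsTypeZero grU
  typeZeroV : IsTypeZero grV
  fU : RU →+* K
  fV : RV →+* K
  fU_surjective : Function.Surjective fU
  fV_surjective : Function.Surjective fV
  fU_eq_zero_iff : ∀ x, fU x = 0 ↔ (DirectSum.decompose grU x 0 : RU) = 0
  fV_eq_zero_iff : ∀ x, fV x = 0 ↔ (DirectSum.decompose grV x 0 : RV) = 0

namespace GridDatum

attribute [instance] fieldK ringU ringV gradedU gradedV

variable (G : GridDatum.{u})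

/-- The grid ring, i.e. the pullback `RU ×_K RV`, as a subring of `RU × RV`. -/
def gridRing : Subring (G.RU × G.RV) :=
  (G.fU.comp (RingHom.fst G.RU G.RV)).eqLocus (G.fV.comp (RingHom.snd G.RU G.RV))

/-- The grid ring as a type. -/
abbrev S : Type u := G.gridRing

/-- The projection `S → RU`. -/
def pU : G.S →+* G.RU := (RingHom.fst G.RU G.RV).comp G.gridRing.subtype

/-- The projection `S → RV`. -/
def pV : G.S →+* G.RV := (RingHom.snd G.RU G.RV).comp G.gridRing.subtype

/-- The projection `S → K`; its kernel is the ideal `(𝔪_U, 𝔪_V)`. -/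
def toK : G.S →+* G.K := G.fU.comp G.pU

instance algebraU : Algebra G.S G.RU := G.pU.toAlgebra

instance algebraV : Algebra G.S G.RV := G.pV.toAlgebra

/-- The inherited grading: `(a, b)` has degree `n` when both `a` and `b` have degree `n`. -/
def gr (n : ℤ × ℤ) : AddSubgroup G.S :=
  (G.grU n).comap G.pU.toAddMonoidHom ⊓ (G.grV n).comap G.pV.toAddMonoidHom

variable {G}

theorem mem_gr {n : ℤ × ℤ} {s : G.S} : s ∈ G.gr n ↔ G.pU s ∈ G.grU n ∧ G.pV s ∈ G.grV n :=
  Iff.rfl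

theorem S_ext {s t : G.S} (hU : G.pU s = G.pU t) (hV : G.pV s = G.pV t) : s = t :=
  Subtype.ext (Prod.ext hU hV)

theorem fU_pU (s : G.S) : G.fU (G.pU s) = G.fV (G.pV s) := s.2

instance : SetLike.GradedMonoid G.gr where
  one_mem := ⟨by simpa using SetLike.GradedOne.one_mem (A := G.grU),
    by simpa using SetLike.GradedOne.one_mem (A := G.grV)⟩
  mul_mem := fun _ _ _ _ ha hb => by
    rw [mem_gr] at *
    rw [map_mul, map_mul]
    exact ⟨SetLike.GradedMul.mul_mem ha.1 hb.1, SetLike.GradedMul.mul_mem ha.2 hb.2⟩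

theorem fU_component (x : G.RU) (n : ℤ × ℤ) :
    G.fU (DirectSum.decompose G.grU x n) = if n = 0 then G.fU x else 0 := by
  split_ifs with h
  · subst h
    rw [← sub_eq_zero, ← map_sub, fU_eq_zero_iff, DirectSum.decompose_sub, DirectSum.sub_apply,
      DirectSum.decompose_coe, DirectSum.of_eq_same, sub_self]
    rfl
  · rw [fU_eq_zero_iff, DirectSum.decompose_coe, DirectSum.of_eq_of_ne _ _ _ (Ne.symm h)]
    rfl

theorem fV_component (x : G.RV) (n : ℤ × ℤ) :
    G.fV (DirectSum.decompose G.grV x n) = if n = 0 then G.fV x else 0 := by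
  split_ifs with h
  · subst h
    rw [← sub_eq_zero, ← map_sub, fV_eq_zero_iff, DirectSum.decompose_sub, DirectSum.sub_apply,
      DirectSum.decompose_coe, DirectSum.of_eq_same, sub_self]
    rfl
  · rw [fV_eq_zero_iff, DirectSum.decompose_coe, DirectSum.of_eq_of_ne _ _ _ (Ne.symm h)]
    rfl

/-- The degree-`n` component of an element of the grid ring. -/
def component (s : G.S) (n : ℤ × ℤ) : G.S :=
  ⟨(DirectSum.decompose G.grU (G.pU s) n, DirectSum.decompose G.grV (G.pV s) n), by
    change G.fU (DirectSum.decompose G.grU (G.pU s) n) =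
      G.fV (DirectSum.decompose G.grV (G.pV s) n)
    rw [fU_component, fV_component, fU_pU]⟩

theorem component_mem (s : G.S) (n : ℤ × ℤ) : component s n ∈ G.gr n :=
  mem_gr.2 ⟨SetLike.coe_mem (DirectSum.decompose G.grU (G.pU s) n),
    SetLike.coe_mem (DirectSum.decompose G.grV (G.pV s) n)⟩

theorem isInternal_gr : DirectSum.IsInternal G.gr := by
  classical
  constructor
  · rw [← AddMonoidHom.coe_coe, injective_iff_map_eq_zero]
    intro x hx
    have key : ∀ (s : DirectSum _ fun n => G.gr n) (n : ℤ × ℤ),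
        DirectSum.decompose G.grU (G.pU (DirectSum.coeAddMonoidHom G.gr s)) n = G.pU (s n) ∧
        DirectSum.decompose G.grV (G.pV (DirectSum.coeAddMonoidHom G.gr s)) n = G.pV (s n) := by
      intro s n
      induction s using DirectSum.induction_on with
      | zero => simp
      | of m y =>
        rw [DirectSum.coeAddMonoidHom_of]
        have hU : G.pU y ∈ G.grU m := y.2.1
        have hV : G.pV y ∈ G.grV m := y.2.2
        by_cases h : m = n
        · subst h
          rw [DirectSum.of_eq_same, DirectSum.decompose_of_mem_same _ hU,
            DirectSum.decompose_of_mem_same _ hV]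
          exact ⟨rfl, rfl⟩
        · rw [DirectSum.of_eq_of_ne _ _ _ (Ne.symm h), DirectSum.decompose_of_mem_ne _ hU h,
            DirectSum.decompose_of_mem_ne _ hV h]
          simp
      | add a b ha hb =>
        simp only [map_add, DirectSum.decompose_add, DirectSum.add_apply, AddMemClass.coe_add,
          ha.1, ha.2, hb.1, hb.2, and_self]
    ext n : 1
    have h := key x n
    have hx' : DirectSum.coeAddMonoidHom G.gr x = 0 := hx
    rw [hx'] at h
    apply Subtype.ext
    exact S_ext (by simpa using h.1.symm) (by simpa using h.2.symm)
  · intro s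
    let T : Finset (ℤ × ℤ) := (DirectSum.decompose G.grU (G.pU s)).support ∪
      (DirectSum.decompose G.grV (G.pV s)).support
    refine ⟨∑ n ∈ T, DirectSum.of (fun n => G.gr n) n ⟨component s n, component_mem s n⟩, ?_⟩
    rw [map_sum]
    simp only [DirectSum.coeAddMonoidHom_of]
    apply S_ext
    · rw [map_sum]
      conv_rhs => rw [← DirectSum.sum_support_decompose G.grU (G.pU s)]
      symm
      apply Finset.sum_subset Finset.subset_union_left
      intro n _ hn
      simpa using hn
    · rw [map_sum]
      conv_rhs => rw [← DirectSum.sum_support_decompose G.grV (G.pV s)]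
      symm
      apply Finset.sum_subset Finset.subset_union_right
      intro n _ hn
      simpa using hn

theorem gr_ne_bot {n : ℤ × ℤ} (h : G.gr n ≠ ⊥) : G.grU n ≠ ⊥ ∨ G.grV n ≠ ⊥ := by
  contrapose! h
  rw [eq_bot_iff]
  intro s hs
  rw [mem_gr, h.1, h.2, AddSubgroup.mem_bot, AddSubgroup.mem_bot] at hs
  exact S_ext (by simpa using hs.1) (by simpa using hs.2)

theorem gr_parity (n : ℤ × ℤ) (h : G.gr n ≠ ⊥) : n.1 ≡ n.2 [ZMOD 2] :=
  (gr_ne_bot h).elim (G.typeZeroU.parity n) (G.typeZeroV.parity n)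

/-- The sign `(-1)^{gr₁}` of a nonzero homogeneous element acts trivially on the grid ring. -/
theorem negOnePow_smul_of_mem {n : ℤ × ℤ} {s : G.S} (hs : s ∈ G.gr n) :
    (n.1.negOnePow : ℤ) • s = s := by
  have hU : (n.1.negOnePow : ℤ) • G.pU s = G.pU s := by
    by_cases h0 : G.pU s = 0
    · rw [h0, smul_zero]
    rcases G.typeZeroU.even_or_neg_one with h | h
    · have := (h n (fun hb => h0 (by simpa [hb] using hs.1))).1
      rw [Int.negOnePow_even _ this]; simp
    · rcases Int.even_or_odd n.1 with e | o
      · rw [Int.negOnePow_even _ e]; simp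
      · rw [Int.negOnePow_odd _ o]
        calc _ = (-1 : G.RU) * G.pU s := by simp
          _ = _ := by rw [h, one_mul]
  have hV : (n.1.negOnePow : ℤ) • G.pV s = G.pV s := by
    by_cases h0 : G.pV s = 0
    · rw [h0, smul_zero]
    rcases G.typeZeroV.even_or_neg_one with h | h
    · have := (h n (fun hb => h0 (by simpa [hb] using hs.2))).1
      rw [Int.negOnePow_even _ this]; simp
    · rcases Int.even_or_odd n.1 with e | o
      · rw [Int.negOnePow_even _ e]; simp
      · rw [Int.negOnePow_odd _ o]
        calc _ = (-1 : G.RV) * G.pV s := by simp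
          _ = _ := by rw [h, one_mul]
  exact S_ext (by rw [map_zsmul, hU]) (by rw [map_zsmul, hV])

end GridDatum

/-! ### Gradings on tensor products and homology modulo torsion -/

/-- The grading on `M ⊗ N`: the degree-`n` piece is generated by the `x ⊗ y` with `x`, `y`
homogeneous of degrees adding up to `n`. -/
def tensorGrading {A M N : Type u} [CommRing A] [AddCommGroup M] [AddCommGroup N] [Module A M]
    [Module A N] (P : ℤ × ℤ → AddSubgroup M) (Q : ℤ × ℤ → AddSubgroup N) (n : ℤ × ℤ) :
    AddSubgroup (M ⊗[A] N) :=
  AddSubgroup.closure {t | ∃ p q x y, x ∈ P p ∧ y ∈ Q q ∧ p + q = n ∧ t = x ⊗ₜ[A] y}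

section Homology

variable {R M N P : Type u} [CommRing R] [AddCommGroup M] [AddCommGroup N] [AddCommGroup P]
  [Module R M] [Module R N] [Module R P]

/-- The homology `ker d / im d` of a differential `d`. -/
abbrev Homology (d : M →ₗ[R] M) : Type u :=
  LinearMap.ker d ⧸ (LinearMap.range d).submoduleOf (LinearMap.ker d)

/-- Homology modulo its torsion submodule. -/
abbrev HomologyModTorsion (d : M →ₗ[R] M) : Type u :=
  Homology d ⧸ Submodule.torsion R (Homology d)

/-- The class of a cycle in homology modulo torsion. -/
def cycleClass (d : M →ₗ[R] M) : LinearMap.ker d →ₗ[R] HomologyModTorsion d :=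
  (Submodule.torsion R (Homology d)).mkQ ∘ₗ
    ((LinearMap.range d).submoduleOf (LinearMap.ker d)).mkQ

theorem cycleClass_surjective (d : M →ₗ[R] M) : Function.Surjective (cycleClass d) :=
  (Submodule.mkQ_surjective _).comp (Submodule.mkQ_surjective _)

/-- The map induced by a chain map on cycles. -/
def cyclesMap {d : M →ₗ[R] M} {d' : N →ₗ[R] N} (φ : M →ₗ[R] N) (h : φ ∘ₗ d = d' ∘ₗ φ) :
    LinearMap.ker d →ₗ[R] LinearMap.ker d' :=
  φ.restrict fun x hx => by
    have := LinearMap.congr_fun h x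
    simp only [LinearMap.comp_apply, LinearMap.mem_ker] at *
    rw [← this, hx, map_zero]

/-- The map induced by a chain map on homology. -/
def homologyMap {d : M →ₗ[R] M} {d' : N →ₗ[R] N} (φ : M →ₗ[R] N) (h : φ ∘ₗ d = d' ∘ₗ φ) :
    Homology d →ₗ[R] Homology d' :=
  Submodule.mapQ _ _ (cyclesMap φ h) (by
    rintro ⟨x, hx⟩ ⟨y, hy⟩
    exact ⟨φ y, by
      have := LinearMap.congr_fun h y
      simp only [LinearMap.comp_apply, Submodule.subtype_apply] at *
      rw [← this, hy]; rfl⟩)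

/-- The map induced by a chain map on homology modulo torsion. -/
def homologyModTorsionMap {d : M →ₗ[R] M} {d' : N →ₗ[R] N} (φ : M →ₗ[R] N)
    (h : φ ∘ₗ d = d' ∘ₗ φ) : HomologyModTorsion d →ₗ[R] HomologyModTorsion d' :=
  Submodule.mapQ _ _ (homologyMap φ h) (by
    rintro x ⟨a, ha⟩
    refine ⟨a, ?_⟩
    have h2 : (a : R) • x = 0 := ha
    change (a : R) • homologyMap φ h x = 0
    rw [← map_smul, h2, map_zero])

theorem homologyModTorsionMap_cycleClass {d : M →ₗ[R] M} {d' : N →ₗ[R] N} (φ : M →ₗ[R] N)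
    (h : φ ∘ₗ d = d' ∘ₗ φ) (z : LinearMap.ker d) :
    homologyModTorsionMap φ h (cycleClass d z) = cycleClass d' (cyclesMap φ h z) := rfl

end Homology

/-! ### Complexes over a grid ring -/

/-- A complex over the grid ring `S`: a free, finitely generated `ℤ × ℤ`-graded `S`-module
(that is, a graded module with a finite homogeneous basis) satisfying `gr₁ ≡ gr₂ mod 2`, with a
differential of degree `(-1, -1)`. -/
structure SComplex (G : GridDatum.{u}) where
  carrier : Type u
  [addCommGroup : AddCommGroup carrier]
  [module : Module G.S carrier]
  gr : ℤ × ℤ → AddSubgroup carrier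
  isInternal : DirectSum.IsInternal gr
  smul_mem : ∀ {m n : ℤ × ℤ} {s : G.S} {x : carrier}, s ∈ G.gr m → x ∈ gr n →
    s • x ∈ gr (m + n)
  exists_basis : ∃ (r : ℕ) (b : Module.Basis (Fin r) G.S carrier) (δ : Fin r → ℤ × ℤ),
    ∀ i, b i ∈ gr (δ i)
  parity : ∀ n : ℤ × ℤ, gr n ≠ ⊥ → n.1 ≡ n.2 [ZMOD 2]
  d : carrier →ₗ[G.S] carrier
  d_mem : ∀ {n : ℤ × ℤ} {x : carrier}, x ∈ gr n → d x ∈ gr (n - (1, 1))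
  d_comp_d : d ∘ₗ d = 0

namespace SComplex

attribute [instance] addCommGroup module

variable {G : GridDatum.{u}}

/-- The trivial complex: `S` itself with zero differential. -/
def trivial (G : GridDatum.{u}) : SComplex G where
  carrier := G.S
  gr := G.gr
  isInternal := GridDatum.isInternal_gr
  smul_mem := fun hs hx => SetLike.GradedMul.mul_mem hs hx
  exists_basis := ⟨1, Module.Basis.singleton (Fin 1) G.S, fun _ => 0, fun i => by
    rw [Module.Basis.singleton_apply]
    exact SetLike.GradedOne.one_mem⟩
  parity := GridDatum.gr_parity
  d := 0
  d_mem := fun _ => zero_mem _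
  d_comp_d := by simp

/-- An additive-subgroup induction principle: homogeneous elements generate. -/
theorem induction_homogeneous {M : Type u} [AddCommGroup M] {P : ℤ × ℤ → AddSubgroup M}
    (hP : DirectSum.IsInternal P) {p : M → Prop} (zero : p 0)
    (hom : ∀ n x, x ∈ P n → p x) (add : ∀ x y, p x → p y → p (x + y)) (x : M) : p x := by
  classical
  obtain ⟨y, rfl⟩ := hP.2 x
  induction y using DirectSum.induction_on with
  | zero => simpa using zero
  | of n y => rw [DirectSum.coeAddMonoidHom_of]; exact hom n _ y.2
  | add a b ha hb => rw [map_add]; exact add _ _ ha hb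

variable (C D E : SComplex G)

/-- The additive map multiplying a homogeneous element `x` by `(-1)^{gr₁ x}`. -/
noncomputable def signAddHom : C.carrier →+ C.carrier :=
  (DirectSum.toAddMonoid fun n : ℤ × ℤ => (n.1.negOnePow : ℤ) • (C.gr n).subtype).comp
    (AddEquiv.ofBijective (DirectSum.coeAddMonoidHom C.gr) C.isInternal).symm.toAddMonoidHom

theorem signAddHom_of_mem {n : ℤ × ℤ} {x : C.carrier} (hx : x ∈ C.gr n) :
    C.signAddHom x = (n.1.negOnePow : ℤ) • x := by
  have : (AddEquiv.ofBijective (DirectSum.coeAddMonoidHom C.gr) C.isInternal).symm x =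
      DirectSum.of (fun n => C.gr n) n ⟨x, hx⟩ := by
    rw [AddEquiv.symm_apply_eq]
    exact (DirectSum.coeAddMonoidHom_of C.gr n ⟨x, hx⟩).symm
  change DirectSum.toAddMonoid _
    ((AddEquiv.ofBijective (DirectSum.coeAddMonoidHom C.gr) C.isInternal).symm x) = _
  rw [this, DirectSum.toAddMonoid_of]
  rfl

/-- The `S`-linear map multiplying a homogeneous element `x` by `(-1)^{gr₁ x}`. -/
noncomputable def sign : C.carrier →ₗ[G.S] C.carrier where
  toFun := C.signAddHom
  map_add' := map_add _
  map_smul' := by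
    intro s x
    simp only [RingHom.id_apply]
    refine induction_homogeneous GridDatum.isInternal_gr (p := fun s =>
      C.signAddHom (s • x) = s • C.signAddHom x) (by simp) ?_ ?_ s
    · intro m s hs
      refine induction_homogeneous C.isInternal (p := fun x =>
        C.signAddHom (s • x) = s • C.signAddHom x) (by simp) ?_ ?_ x
      · intro n x hx
        rw [C.signAddHom_of_mem (C.smul_mem hs hx), C.signAddHom_of_mem hx, Prod.fst_add,
          Int.negOnePow_add, Units.val_mul, mul_comm, mul_smul, ← smul_assoc _ s x,
          GridDatum.negOnePow_smul_of_mem hs, smul_comm]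
      · intro x y hx hy
        rw [smul_add, map_add, hx, hy, map_add, smul_add]
    · intro s t hs ht
      rw [add_smul, map_add, hs, ht, add_smul]

theorem sign_of_mem {n : ℤ × ℤ} {x : C.carrier} (hx : x ∈ C.gr n) :
    C.sign x = (n.1.negOnePow : ℤ) • x := C.signAddHom_of_mem hx

theorem sign_mem {n : ℤ × ℤ} {x : C.carrier} (hx : x ∈ C.gr n) : C.sign x ∈ C.gr n := by
  rw [C.sign_of_mem hx]
  exact zsmul_mem hx _

theorem sign_d (x : C.carrier) : C.sign (C.d x) = - C.d (C.sign x) := by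
  refine induction_homogeneous C.isInternal (p := fun x =>
    C.sign (C.d x) = - C.d (C.sign x)) (by simp) ?_ ?_ x
  · intro n x hx
    rw [C.sign_of_mem (C.d_mem hx), C.sign_of_mem hx, map_zsmul, Prod.fst_sub,
      Int.negOnePow_sub, Int.negOnePow_one]
    simp
  · intro x y hx hy
    simp only [map_add, hx, hy, neg_add]

/-- In a module with homogeneous basis `b` in degrees `δ`, an element is homogeneous of
degree `n` exactly if its coefficients are homogeneous of degrees `n - δ i`. -/
theorem mem_gr_iff_repr {r : ℕ} (b : Module.Basis (Fin r) G.S C.carrier) (δ : Fin r → ℤ × ℤ)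
    (hb : ∀ i, b i ∈ C.gr (δ i)) (n : ℤ × ℤ) (x : C.carrier) :
    x ∈ C.gr n ↔ ∀ i, b.repr x i ∈ G.gr (n - δ i) := by
  classical
  have easy : ∀ (m : ℤ × ℤ) (c : Fin r → G.S), (∀ i, c i ∈ G.gr (m - δ i)) →
      ∑ i, c i • b i ∈ C.gr m := fun m c hc => sum_mem fun i _ => by
    have := C.smul_mem (hc i) (hb i)
    rwa [sub_add_cancel] at this
  constructor
  · intro hx
    let _ : DirectSum.Decomposition G.gr := GridDatum.isInternal_gr.chooseDecomposition
    let _ : DirectSum.Decomposition C.gr := C.isInternal.chooseDecomposition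
    let c : ℤ × ℤ → Fin r → G.S := fun m i =>
      DirectSum.decompose G.gr (b.repr x i) (m - δ i)
    have hc : ∀ m i, c m i ∈ G.gr (m - δ i) := fun m i => SetLike.coe_mem _
    have comp : ∀ y : C.carrier, (DirectSum.decompose C.gr y n : C.carrier) =
        ∑ i, (DirectSum.decompose G.gr (b.repr y i) (n - δ i) : G.S) • b i := by
      intro y
      have key : ∀ (s : G.S) (i : Fin r), (DirectSum.decompose C.gr (s • b i) n : C.carrier) =
          (DirectSum.decompose G.gr s (n - δ i) : G.S) • b i := by
        intro s i
        refine induction_homogeneous GridDatum.isInternal_gr (p := fun s =>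
          (DirectSum.decompose C.gr (s • b i) n : C.carrier) =
          (DirectSum.decompose G.gr s (n - δ i) : G.S) • b i) (by simp) ?_ ?_ s
        · intro m s hs
          have hsb := C.smul_mem hs (hb i)
          by_cases h : m = n - δ i
          · subst h
            rw [DirectSum.decompose_of_mem_same _ hs]
            rw [sub_add_cancel] at hsb
            rw [DirectSum.decompose_of_mem_same _ hsb]
          · rw [DirectSum.decompose_of_mem_ne _ hs h, zero_smul,
              DirectSum.decompose_of_mem_ne _ hsb (fun e => h (eq_sub_of_add_eq e))]
        · intro s t hs ht
          rw [add_smul, DirectSum.decompose_add, DirectSum.add_apply, AddMemClass.coe_add, hs, ht,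
            DirectSum.decompose_add, DirectSum.add_apply, AddMemClass.coe_add, add_smul]
      conv_lhs => rw [← b.sum_repr y]
      rw [DirectSum.decompose_sum, DFinsupp.finsetSum_apply, AddSubmonoidClass.coe_finsetSum]
      exact Finset.sum_congr rfl fun i _ => key _ i
    have h := comp x
    rw [DirectSum.decompose_of_mem_same _ hx] at h
    intro i
    rw [h, b.repr_sum_self]
    exact hc n i
  · intro h
    rw [← b.sum_repr x]
    exact easy n _ h

/-- If homogeneity can be read off coefficients in a basis, the grading is internal. -/
theorem isInternal_of_repr {ι M : Type*} [Fintype ι] [AddCommGroup M] [Module G.S M]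
    (P : ℤ × ℤ → AddSubgroup M) (b : Module.Basis ι G.S M) (δ : ι → ℤ × ℤ)
    (h : ∀ n x, x ∈ P n ↔ ∀ i, b.repr x i ∈ G.gr (n - δ i)) : DirectSum.IsInternal P := by
  classical
  let _ : DirectSum.Decomposition G.gr := GridDatum.isInternal_gr.chooseDecomposition
  constructor
  · rw [← AddMonoidHom.coe_coe, injective_iff_map_eq_zero]
    intro x hx
    have key : ∀ (y : DirectSum _ fun n => P n) (n : ℤ × ℤ) (i : ι),
        (DirectSum.decompose G.gr (b.repr (DirectSum.coeAddMonoidHom P y) i) (n - δ i) : G.S) =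
        b.repr (y n) i := by
      intro y n i
      induction y using DirectSum.induction_on with
      | zero => simp
      | of m y =>
        rw [DirectSum.coeAddMonoidHom_of]
        have hy := (h m y).1 y.2 i
        by_cases e : m = n
        · subst e
          rw [DirectSum.of_eq_same, DirectSum.decompose_of_mem_same _ hy]
        · rw [DirectSum.of_eq_of_ne _ _ _ (Ne.symm e),
            DirectSum.decompose_of_mem_ne _ hy (fun e' => e (sub_left_injective e'))]
          simp
      | add a c ha hc =>
        simp only [map_add, Finsupp.add_apply, DirectSum.decompose_add, DirectSum.add_apply,
          AddMemClass.coe_add, ha, hc]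
    have hx' : DirectSum.coeAddMonoidHom P x = 0 := hx
    ext n : 1
    apply Subtype.ext
    apply b.repr.injective
    ext i : 1
    rw [← key x n i, hx']
    simp
  · intro x
    change x ∈ AddMonoidHom.range (DirectSum.coeAddMonoidHom P)
    rw [← b.sum_repr x]
    refine sum_mem fun i _ => ?_
    refine induction_homogeneous GridDatum.isInternal_gr (p := fun s =>
      s • b i ∈ AddMonoidHom.range (DirectSum.coeAddMonoidHom P)) (by simp) ?_ ?_ (b.repr x i)
    · intro m s hs
      have hm : s • b i ∈ P (m + δ i) := by
        rw [h]
        intro j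
        by_cases e : i = j
        · subst e
          simpa using hs
        · simp [Finsupp.single_eq_of_ne (Ne.symm e)]
      exact ⟨DirectSum.of (fun n => P n) _ ⟨_, hm⟩, DirectSum.coeAddMonoidHom_of P _ _⟩
    · intro s t hs ht
      rw [add_smul]
      exact add_mem hs ht

theorem tensorGrading_smul_mem {m n : ℤ × ℤ} {s : G.S} {x : C.carrier ⊗[G.S] D.carrier}
    (hs : s ∈ G.gr m) (hx : x ∈ tensorGrading (A := G.S) C.gr D.gr n) :
    s • x ∈ tensorGrading (A := G.S) C.gr D.gr (m + n) := by
  induction hx using AddSubgroup.closure_induction with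
  | mem x hx =>
    obtain ⟨p, q, a, c, ha, hc, rfl, rfl⟩ := hx
    refine AddSubgroup.subset_closure ⟨m + p, q, s • a, c, C.smul_mem hs ha, hc, ?_, ?_⟩
    · rw [add_assoc]
    · rw [TensorProduct.smul_tmul']
  | zero => rw [smul_zero]; exact zero_mem _
  | add x y _ _ hx hy => rw [smul_add]; exact add_mem hx hy
  | neg x _ hx => rw [smul_neg]; exact neg_mem hx

theorem mem_tensorGrading_iff_repr {r t : ℕ} (b : Module.Basis (Fin r) G.S C.carrier)
    (δ : Fin r → ℤ × ℤ) (hb : ∀ i, b i ∈ C.gr (δ i)) (c : Module.Basis (Fin t) G.S D.carrier)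
    (ε : Fin t → ℤ × ℤ) (hc : ∀ i, c i ∈ D.gr (ε i)) (n : ℤ × ℤ)
    (x : C.carrier ⊗[G.S] D.carrier) :
    x ∈ tensorGrading (A := G.S) C.gr D.gr n ↔
      ∀ i, (b.tensorProduct c).repr x i ∈ G.gr (n - (δ i.1 + ε i.2)) := by
  constructor
  · intro hx
    induction hx using AddSubgroup.closure_induction with
    | mem x hx =>
      obtain ⟨p, q, y, z, hy, hz, rfl, rfl⟩ := hx
      rintro ⟨i, j⟩
      rw [Module.Basis.tensorProduct_repr_tmul_apply]
      have h := SetLike.GradedMul.mul_mem ((D.mem_gr_iff_repr c ε hc q z).1 hz j)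
        ((C.mem_gr_iff_repr b δ hb p y).1 hy i)
      have e : q - ε j + (p - δ i) = p + q - (δ i + ε j) := by abel
      rw [e] at h
      simpa [mul_comm] using h
    | zero => intro i; simp
    | add x y _ _ hx hy => intro i; simpa using add_mem (hx i) (hy i)
    | neg x _ hx => intro i; simpa using hx i
  · intro h
    rw [← (b.tensorProduct c).sum_repr x]
    refine sum_mem fun i _ => ?_
    have h1 : b i.1 ⊗ₜ[G.S] c i.2 ∈ tensorGrading (A := G.S) C.gr D.gr (δ i.1 + ε i.2) :=
      AddSubgroup.subset_closure ⟨_, _, _, _, hb i.1, hc i.2, rfl, rfl⟩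
    have h2 := tensorGrading_smul_mem C D (h i) h1
    rw [sub_add_cancel] at h2
    rwa [Module.Basis.tensorProduct_apply']

/-- The differential `∂(a ⊗ b) = ∂a ⊗ b + (-1)^{|a|} a ⊗ ∂b` on the tensor product. -/
noncomputable def tensorD : C.carrier ⊗[G.S] D.carrier →ₗ[G.S] C.carrier ⊗[G.S] D.carrier :=
  TensorProduct.map C.d LinearMap.id + TensorProduct.map C.sign D.d

theorem tensorD_tmul {n : ℤ × ℤ} {a : C.carrier} (ha : a ∈ C.gr n) (b : D.carrier) :
    tensorD C D (a ⊗ₜ b) = C.d a ⊗ₜ b + (n.1.negOnePow : ℤ) • (a ⊗ₜ D.d b) := by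
  simp [tensorD, C.sign_of_mem ha, TensorProduct.smul_tmul']

/-- The product of two complexes: the tensor product complex over the grid ring. -/
noncomputable def tensor : SComplex G where
  carrier := C.carrier ⊗[G.S] D.carrier
  gr := tensorGrading (A := G.S) C.gr D.gr
  isInternal := by
    obtain ⟨r, b, δ, hb⟩ := C.exists_basis
    obtain ⟨t, c, ε, hc⟩ := D.exists_basis
    exact isInternal_of_repr _ (b.tensorProduct c) (fun i => δ i.1 + ε i.2)
      (mem_tensorGrading_iff_repr C D b δ hb c ε hc)
  smul_mem := tensorGrading_smul_mem C D
  exists_basis := by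
    obtain ⟨r, b, δ, hb⟩ := C.exists_basis
    obtain ⟨t, c, ε, hc⟩ := D.exists_basis
    refine ⟨r * t, (b.tensorProduct c).reindex finProdFinEquiv,
      fun k => δ (finProdFinEquiv.symm k).1 + ε (finProdFinEquiv.symm k).2, fun k => ?_⟩
    rw [Module.Basis.reindex_apply, Module.Basis.tensorProduct_apply']
    exact AddSubgroup.subset_closure ⟨_, _, _, _, hb _, hc _, rfl, rfl⟩
  parity := by
    intro n hn
    by_contra hpar
    apply hn
    rw [tensorGrading, AddSubgroup.closure_eq_bot_iff]
    rintro _ ⟨p, q, x, y, hx, hy, rfl, rfl⟩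
    by_cases hp : C.gr p = ⊥
    · rw [hp, AddSubgroup.mem_bot] at hx
      simp [hx]
    by_cases hq : D.gr q = ⊥
    · rw [hq, AddSubgroup.mem_bot] at hy
      simp [hy]
    exact absurd ((C.parity p hp).add (D.parity q hq)) hpar
  d := tensorD C D
  d_mem := by
    intro n x hx
    induction hx using AddSubgroup.closure_induction with
    | mem x hx =>
      obtain ⟨p, q, x, y, hx, hy, rfl, rfl⟩ := hx
      rw [tensorD_tmul C D hx]
      have h1 : C.d x ⊗ₜ[G.S] y ∈ tensorGrading (A := G.S) C.gr D.gr (p + q - (1, 1)) :=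
        AddSubgroup.subset_closure ⟨p - (1, 1), q, _, _, C.d_mem hx, hy, by abel, rfl⟩
      have h2 : x ⊗ₜ[G.S] D.d y ∈ tensorGrading (A := G.S) C.gr D.gr (p + q - (1, 1)) :=
        AddSubgroup.subset_closure ⟨p, q - (1, 1), _, _, hx, D.d_mem hy, by abel, rfl⟩
      exact add_mem h1 (zsmul_mem h2 _)
    | zero => rw [map_zero]; exact zero_mem _
    | add x y _ _ hx hy => rw [map_add]; exact add_mem hx hy
    | neg x _ hx => rw [map_neg]; exact neg_mem hx
  d_comp_d := by
    apply TensorProduct.ext'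
    intro x y
    have h1 : C.d (C.d x) = 0 := LinearMap.congr_fun C.d_comp_d x
    have h2 : D.d (D.d y) = 0 := LinearMap.congr_fun D.d_comp_d y
    simp [tensorD, h1, h2, C.sign_d, TensorProduct.neg_tmul]

/-! ### Knotlike complexes and local maps -/

/-- `C` is reduced: `∂ ≡ 0` modulo `(𝔪_U, 𝔪_V)`. -/
def IsReduced : Prop :=
  ∀ x, C.d x ∈ RingHom.ker G.toK • (⊤ : Submodule G.S C.carrier)

/-- The `U`-tower condition: modulo torsion, the homology of `C ⊗ RU` is isomorphic to `RU` by
an isomorphism preserving `gr₂` and homogeneous with respect to `gr₁`. -/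
def IsLeftKnotlike : Prop :=
  ∃ (e : HomologyModTorsion (C.d.baseChange G.RU) ≃ₗ[G.RU] G.RU) (j : ℤ),
    ∀ (n : ℤ × ℤ) (z : LinearMap.ker (C.d.baseChange G.RU)),
      (z : G.RU ⊗[G.S] C.carrier) ∈ tensorGrading (A := G.S) G.grU C.gr n →
        e (cycleClass _ z) ∈ G.grU (n + (j, 0))

/-- The `V`-tower condition: modulo torsion, the homology of `C ⊗ RV` is isomorphic to `RV` by
an isomorphism preserving `gr₁` and homogeneous with respect to `gr₂`. -/
def IsRightKnotlike : Prop :=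
  ∃ (e : HomologyModTorsion (C.d.baseChange G.RV) ≃ₗ[G.RV] G.RV) (j : ℤ),
    ∀ (n : ℤ × ℤ) (z : LinearMap.ker (C.d.baseChange G.RV)),
      (z : G.RV ⊗[G.S] C.carrier) ∈ tensorGrading (A := G.S) G.grV C.gr n →
        e (cycleClass _ z) ∈ G.grV (n + (0, j))

/-- A (totally) knotlike complex; all knotlike complexes are taken to be reduced. -/
structure IsKnotlike : Prop where
  reduced : C.IsReduced
  left : C.IsLeftKnotlike
  right : C.IsRightKnotlike

variable {C D E}

theorem baseChange_chain {f : C.carrier →ₗ[G.S] D.carrier} (h : f ∘ₗ C.d = D.d ∘ₗ f) :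
    f.baseChange G.RV ∘ₗ C.d.baseChange G.RV = D.d.baseChange G.RV ∘ₗ f.baseChange G.RV := by
  rw [← LinearMap.baseChange_comp, h, LinearMap.baseChange_comp]

/-- A (right) local map: an `S`-linear chain map that preserves `gr₁`, is homogeneous with
respect to `gr₂`, and induces an isomorphism on the homology of `C ⊗ RV` modulo torsion. -/
structure IsLocalMap (f : C.carrier →ₗ[G.S] D.carrier) : Prop where
  chain : f ∘ₗ C.d = D.d ∘ₗ f
  homogeneous : ∃ j : ℤ, ∀ (n : ℤ × ℤ) (x : C.carrier), x ∈ C.gr n → f x ∈ D.gr (n + (0, j))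
  bijective : Function.Bijective
    (homologyModTorsionMap (f.baseChange G.RV) (baseChange_chain chain))

theorem isLocalMap_id : IsLocalMap (C := C) (D := C) LinearMap.id where
  chain := rfl
  homogeneous := ⟨0, fun n x hx => by simpa [← Prod.zero_eq_mk] using hx⟩
  bijective := by
    have : ∀ y, homologyModTorsionMap (d := C.d.baseChange G.RV) (d' := C.d.baseChange G.RV)
        ((LinearMap.id : C.carrier →ₗ[G.S] C.carrier).baseChange G.RV)
        (baseChange_chain rfl) y = y := by
      intro y
      obtain ⟨z, rfl⟩ := cycleClass_surjective _ y
      rw [homologyModTorsionMap_cycleClass]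
      congr 1
      apply Subtype.ext
      change (LinearMap.id : C.carrier →ₗ[G.S] C.carrier).baseChange G.RV z.1 = z.1
      rw [LinearMap.baseChange_id]; rfl
    exact (funext this : _ = id) ▸ Function.bijective_id

theorem IsLocalMap.comp {g : D.carrier →ₗ[G.S] E.carrier} {f : C.carrier →ₗ[G.S] D.carrier}
    (hg : IsLocalMap g) (hf : IsLocalMap f) : IsLocalMap (g ∘ₗ f) where
  chain := by
    rw [LinearMap.comp_assoc, hf.chain, ← LinearMap.comp_assoc, hg.chain, LinearMap.comp_assoc]
  homogeneous := by
    obtain ⟨i, hi⟩ := hf.homogeneous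
    obtain ⟨j, hj⟩ := hg.homogeneous
    refine ⟨i + j, fun n x hx => ?_⟩
    have h := hj _ _ (hi n x hx)
    have e : n + (0, i) + (0, j) = n + (0, i + j) := by ext <;> simp [add_assoc]
    rwa [e] at h
  bijective := by
    have h := hg.bijective.comp hf.bijective
    convert h using 1
    funext y
    obtain ⟨z, rfl⟩ := cycleClass_surjective _ y
    simp only [Function.comp_apply, homologyModTorsionMap_cycleClass]
    congr 1
    apply Subtype.ext
    change (g ∘ₗ f).baseChange G.RV z.1 = g.baseChange G.RV (f.baseChange G.RV z.1)
    rw [LinearMap.baseChange_comp]; rfl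

/-- There is a local map from `C` to `D`. -/
def LocalLE (C D : SComplex G) : Prop :=
  ∃ f : C.carrier →ₗ[G.S] D.carrier, IsLocalMap f

end SComplex

/-- The knotlike complexes over the grid ring. -/
def KnotlikeComplex (G : GridDatum.{u}) : Type (u + 1) :=
  {C : SComplex G // C.IsKnotlike}

/-- `C ≤ D` if there is a local map from `C` to `D`. -/
instance (G : GridDatum.{u}) : Preorder (KnotlikeComplex G) where
  le C D := SComplex.LocalLE C.1 D.1
  le_refl _ := ⟨_, SComplex.isLocalMap_id⟩
  le_trans _ _ _ := fun ⟨_, hf⟩ ⟨_, hg⟩ => ⟨_, hg.comp hf⟩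

/-- The set of local equivalence classes of knotlike complexes, where `C` and `D` are locally
equivalent if `C ≤ D` and `D ≤ C`. It carries the induced partial order. -/
abbrev LocalClasses (G : GridDatum.{u}) : Type (u + 1) :=
  Antisymmetrization (KnotlikeComplex G) (· ≤ ·)

/-- The local equivalence class of a knotlike complex. -/
abbrev localClass {G : GridDatum.{u}} (C : KnotlikeComplex G) : LocalClasses G :=
  toAntisymmetrization (· ≤ ·) C

/-! Total divisibility of homogeneous elements gives linear algebra over `RU` and `RV` in place of a
principal ideal hypothesis: a homogeneous map `d` of finite graded free modules admits a homogeneous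
`q` with `d q = d` and `q = 0` on `ker d` (`exists_projection`), so `1 - q` projects onto the
cycles. With it, a statement about homology modulo torsion lifts to the chain level
(`exists_towerSplitting`). A tower becomes a homogeneous cycle `x`, a functional `p` vanishing on
boundaries with `p x = 1`, and a null-homotopy of `a (1 - x p)` for some `a ≠ 0`. Such data pass to
tensor products and duals by explicit formulas, with no Künneth or universal coefficient theorem,
and a chain map is an isomorphism modulo torsion exactly when `p' (f x)` is a unit
(`TowerSplitting.bijective_iff`).

The group structure follows. Products of knotlike complexes are knotlike, and products of local maps
are local because products of units are units. Unit, associativity and commutativity come from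
homogeneous isomorphisms of complexes. The inverse of `C` is its dual: evaluation and coevaluation
are chain maps whose effect on towers is `p x = 1`. Throughout, `(-1)^{gr₁}` acts trivially on
homogeneous scalars, so the Koszul signs are given by linear maps.

For totality, translation reduces to comparing `C` with the trivial complex (`localLE_trivial_or`).
As `S` is a fibre product over `K`, elements of `C` and functionals on `C` are pairs over `RU` and
`RV` with equal reductions. In the tower degree consider three things over `K`: the reductions of
cycles over `RU`, the reductions of cycles in `ker p` over `RV`, and the reduction `v` of `x`. If
`v` lies in the sum of the two subspaces, a cycle generating the tower can be glued, which gives a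
local map from `S`. Otherwise a linear functional separates `v` from that sum; its lifts, corrected
by the projections `q`, glue to a cocycle, which is a local map to `S`. -/

set_option linter.unusedSectionVars false

/-! ### Graded modules with a homogeneous basis -/

section GradedBasis

open DirectSum

variable {ι κ R M N : Type*} [CommRing R] [AddCommGroup M] [Module R M] [AddCommGroup N]
  [Module R N] [Fintype ι] [Fintype κ] (𝒜 : ℤ × ℤ → AddSubgroup R) [GradedRing 𝒜]

/-- `P` is the grading of the free module `M` for which the basis vector `b i` is homogeneous
of degree `δ i`. -/
def IsGradedBasis (P : ℤ × ℤ → AddSubgroup M) (b : Module.Basis ι R M) (δ : ι → ℤ × ℤ) : Prop :=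
  ∀ n x, x ∈ P n ↔ ∀ i, b.repr x i ∈ 𝒜 (n - δ i)

theorem decompose_sum_mul {c a : ι → R} {m : ι → ℤ × ℤ} (ha : ∀ i, a i ∈ 𝒜 (m i)) (n : ℤ × ℤ) :
    (decompose 𝒜 (∑ i, c i * a i) n : R) = ∑ i, (decompose 𝒜 (c i) (n - m i) : R) * a i := by
  rw [decompose_sum, DFinsupp.finsetSum_apply, AddSubmonoidClass.coe_finsetSum]
  refine Finset.sum_congr rfl fun i _ => ?_
  have h := coe_decompose_mul_add_of_right_mem 𝒜 (a := c i) (i := n - m i) (ha i)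
  rwa [sub_add_cancel] at h

/-- The degree-`n` component of an element of a module with a homogeneous basis. -/
noncomputable def gradedComponent (b : Module.Basis ι R M) (δ : ι → ℤ × ℤ) (n : ℤ × ℤ) :
    M →+ M where
  toFun z := ∑ i, (decompose 𝒜 (b.repr z i) (n - δ i) : R) • b i
  map_zero' := by simp
  map_add' x y := by simp [add_smul, Finset.sum_add_distrib]

variable {𝒜} {P : ℤ × ℤ → AddSubgroup M} {Q : ℤ × ℤ → AddSubgroup N}
  {b : Module.Basis ι R M} {δ : ι → ℤ × ℤ} {c : Module.Basis κ R N} {ε : κ → ℤ × ℤ}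

theorem gradedComponent_apply (n : ℤ × ℤ) (z : M) : gradedComponent 𝒜 b δ n z =
    ∑ i, (decompose 𝒜 (b.repr z i) (n - δ i) : R) • b i := rfl

theorem repr_gradedComponent (n : ℤ × ℤ) (z : M) (i : ι) :
    b.repr (gradedComponent 𝒜 b δ n z) i = decompose 𝒜 (b.repr z i) (n - δ i) := by
  rw [gradedComponent_apply, b.repr_sum_self]

theorem gradedComponent_smul_basis (n : ℤ × ℤ) (r : R) (i : ι) :
    gradedComponent 𝒜 b δ n (r • b i) = (decompose 𝒜 r (n - δ i) : R) • b i := by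
  classical
  apply b.repr.injective
  ext j
  rw [repr_gradedComponent]
  by_cases h : i = j
  · subst h; simp
  · simp [Finsupp.single_eq_of_ne (Ne.symm h)]

namespace IsGradedBasis

theorem basis_mem (h : IsGradedBasis 𝒜 P b δ) (i : ι) : b i ∈ P (δ i) := by
  classical
  rw [h]
  intro j
  by_cases e : i = j
  · subst e; simpa using SetLike.GradedOne.one_mem (A := 𝒜)
  · simp [Finsupp.single_eq_of_ne (Ne.symm e)]

theorem gradedComponent_mem (h : IsGradedBasis 𝒜 P b δ) (n : ℤ × ℤ) (z : M) :
    gradedComponent 𝒜 b δ n z ∈ P n := by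
  rw [h]
  intro i
  rw [repr_gradedComponent]
  exact SetLike.coe_mem _

theorem gradedComponent_of_mem (h : IsGradedBasis 𝒜 P b δ) {n : ℤ × ℤ} {z : M} (hz : z ∈ P n) :
    gradedComponent 𝒜 b δ n z = z := by
  apply b.repr.injective
  ext i
  rw [repr_gradedComponent, decompose_of_mem_same _ ((h n z).1 hz i)]

theorem smul_mem (h : IsGradedBasis 𝒜 P b δ) {m n : ℤ × ℤ} {r : R} {z : M} (hr : r ∈ 𝒜 m)
    (hz : z ∈ P n) : r • z ∈ P (m + n) := by
  rw [h] at hz ⊢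
  intro i
  have := SetLike.GradedMul.mul_mem hr (hz i)
  rw [← add_sub_assoc] at this
  simpa using this

/-- Each `p (b i)` is homogeneous, so multiplying by it only shifts degrees. That homogeneous maps
commute with taking components is what allows relations and cycles to be replaced by homogeneous
ones. -/
theorem decompose_map {p : M →ₗ[R] R} {w : ℤ × ℤ} (hp : ∀ i, p (b i) ∈ 𝒜 (δ i + w))
    (n : ℤ × ℤ) (z : M) :
    (decompose 𝒜 (p z) (n + w) : R) = p (gradedComponent 𝒜 b δ n z) := by
  have e : p z = ∑ i, b.repr z i * p (b i) := by
    conv_lhs => rw [← b.sum_repr z]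
    simp only [map_sum, map_smul, smul_eq_mul]
  rw [e, decompose_sum_mul 𝒜 hp, gradedComponent_apply, map_sum]
  refine Finset.sum_congr rfl fun i _ => ?_
  rw [map_smul, smul_eq_mul, add_sub_add_right_eq_sub]

theorem map_gradedComponent (hQ : IsGradedBasis 𝒜 Q c ε) {F : M →ₗ[R] N} {w : ℤ × ℤ}
    (hF : ∀ i, F (b i) ∈ Q (δ i + w)) (n : ℤ × ℤ) (z : M) :
    F (gradedComponent 𝒜 b δ n z) = gradedComponent 𝒜 c ε (n + w) (F z) := by
  apply c.repr.injective
  ext k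
  rw [repr_gradedComponent]
  have h := decompose_map (𝒜 := 𝒜) (b := b) (δ := δ) (p := c.coord k ∘ₗ F) (w := w - ε k)
    (fun i => by
      have := (hQ _ _).1 (hF i) k
      rwa [add_sub_assoc] at this) n z
  rw [← add_sub_assoc] at h
  exact h.symm

theorem map_mem_of_basis (hP : IsGradedBasis 𝒜 P b δ) (hQ : IsGradedBasis 𝒜 Q c ε)
    {F : M →ₗ[R] N} {w : ℤ × ℤ} (hF : ∀ i, F (b i) ∈ Q (δ i + w)) {n : ℤ × ℤ} {z : M}
    (hz : z ∈ P n) : F z ∈ Q (n + w) := by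
  rw [← hP.gradedComponent_of_mem hz, hQ.map_gradedComponent hF]
  exact hQ.gradedComponent_mem _ _

theorem apply_mem_of_basis (hP : IsGradedBasis 𝒜 P b δ) {p : M →ₗ[R] R} {w : ℤ × ℤ}
    (hp : ∀ i, p (b i) ∈ 𝒜 (δ i + w)) {n : ℤ × ℤ} {z : M} (hz : z ∈ P n) : p z ∈ 𝒜 (n + w) := by
  rw [← hP.gradedComponent_of_mem hz, ← decompose_map hp]
  exact SetLike.coe_mem _

end IsGradedBasis

end GradedBasis

/-! ### Splitting a differential over a graded valuation ring -/

section Section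

open DirectSum

/-- Supplies the pivot in the elimination argument over a graded valuation ring. -/
theorem exists_forall_dvd {ι R : Type*} [CommRing R] {c : ι → R} {s : Finset ι}
    (hs : s.Nonempty) (h : ∀ i j, c i ∣ c j ∨ c j ∣ c i) : ∃ j ∈ s, ∀ i ∈ s, c j ∣ c i := by
  induction hs using Finset.Nonempty.cons_induction with
  | singleton a => exact ⟨a, by simp⟩
  | cons a s ha hs ih =>
    obtain ⟨j, hj, hd⟩ := ih
    rcases h a j with h1 | h1
    · refine ⟨a, by simp, fun i hi => ?_⟩
      rcases Finset.mem_cons.1 hi with rfl | hi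
      · exact dvd_rfl
      · exact h1.trans (hd i hi)
    · refine ⟨j, by simp [hj], fun i hi => ?_⟩
      rcases Finset.mem_cons.1 hi with rfl | hi
      · exact h1
      · exact hd i hi

variable {ι κ : Type*} {R M N : Type u} [CommRing R] [AddCommGroup M] [Module R M]
  [AddCommGroup N] [Module R N] [Fintype ι] [Fintype κ] {𝒜 : ℤ × ℤ → AddSubgroup R}
  [GradedRing 𝒜] {P : ℤ × ℤ → AddSubgroup M} {Q : ℤ × ℤ → AddSubgroup N}
  {b : Module.Basis ι R M} {δ : ι → ℤ × ℤ} {c : Module.Basis κ R N} {ε : κ → ℤ × ℤ}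

/-- Over a graded valuation ring, the image of a homogeneous map of graded free modules has a
basis consisting of images of basis vectors. -/
theorem exists_linearIndepOn_map_basis (hA : IsGradedValuationRing 𝒜)
    (hQ : IsGradedBasis 𝒜 Q c ε) {d : M →ₗ[R] N} {w : ℤ × ℤ}
    (hd : ∀ i, d (b i) ∈ Q (δ i + w)) : ∃ T : Finset ι,
      LinearIndepOn R (fun i => d (b i)) (T : Set ι) ∧
      Submodule.span R ((fun i => d (b i)) '' T) = LinearMap.range d := by
  classical
  have _ := hA.isDomain
  -- Take a spanning set of images of smallest size; a nontrivial relation would allow one of its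
  -- members to be dropped.
  let good : Finset (Finset ι) := Finset.univ.filter fun T =>
    Submodule.span R ((fun i => d (b i)) '' T) = LinearMap.range d
  have hne : good.Nonempty := ⟨Finset.univ, by
    simp only [good, Finset.mem_filter, Finset.mem_univ, true_and, Finset.coe_univ,
      Set.image_univ]
    change Submodule.span R (Set.range (d ∘ b)) = _
    rw [Set.range_comp, ← Submodule.map_span, b.span_eq, Submodule.map_top]⟩
  obtain ⟨T, hT, hmin⟩ := Finset.exists_min_image good Finset.card hne
  have hspan := (Finset.mem_filter.1 hT).2
  refine ⟨T, ?_, hspan⟩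
  rw [linearIndepOn_finset_iff]
  intro f hf
  by_contra! hcon
  obtain ⟨i₀, hi₀, hfi₀⟩ := hcon
  obtain ⟨m, hm⟩ : ∃ m, (decompose 𝒜 (f i₀) m : R) ≠ 0 := by
    by_contra! h
    exact hfi₀ (by rw [← sum_support_decompose 𝒜 (f i₀)]; simp [h])
  -- The degree-`n` part of the relation is again a relation, now with homogeneous coefficients.
  -- This `n` makes the coefficient at `i₀` the nonzero component just found.
  let n := m + δ i₀
  let a : ι → R := fun i => decompose 𝒜 (f i) (n - δ i)
  have ha₀ : a i₀ ≠ 0 := by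
    change (decompose 𝒜 (f i₀) (m + δ i₀ - δ i₀) : R) ≠ 0
    rwa [add_sub_cancel_right]
  have hrel : ∑ i ∈ T, a i • d (b i) = 0 := by
    have h := hQ.map_gradedComponent hd n (∑ i ∈ T, f i • b i)
    have h2 : d (∑ i ∈ T, f i • b i) = 0 := by simpa using hf
    rw [h2, map_zero, map_sum, map_sum] at h
    rw [← h]
    refine Finset.sum_congr rfl fun i _ => ?_
    rw [gradedComponent_smul_basis, map_smul]
  obtain ⟨j, hj, hdvd⟩ := exists_forall_dvd (c := a) (s := T.filter fun i => a i ≠ 0)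
    ⟨i₀, by simp [hi₀, ha₀]⟩
    (fun i j => hA.dvd_total _ _ ⟨_, SetLike.coe_mem _⟩ ⟨_, SetLike.coe_mem _⟩)
  obtain ⟨hjT, haj⟩ := Finset.mem_filter.1 hj
  have hdvd' : ∀ i, i ∈ T → a j ∣ a i := fun i hi => by
    by_cases h : a i = 0
    · rw [h]; exact dvd_zero _
    · exact hdvd i (Finset.mem_filter.2 ⟨hi, h⟩)
  choose! e he using hdvd'
  have hej : e j = 1 := by
    have := he j hjT
    exact (mul_left_cancel₀ haj (by rw [mul_one]; exact this)).symm
  -- The pivot `a j` divides every coefficient, and `N` is free over a domain, so it cancels. The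
  -- coefficient of `d (b j)` becomes 1.
  have hsum : ∑ i ∈ T, e i • d (b i) = 0 := by
    have h : a j • ∑ i ∈ T, e i • d (b i) = 0 := by
      rw [← hrel, Finset.smul_sum]
      refine Finset.sum_congr rfl fun i hi => ?_
      rw [smul_smul, ← he i hi]
    apply c.repr.injective
    ext k
    have hk := congrArg (fun x => c.repr x k) h
    simp only [map_smul, Finsupp.smul_apply, smul_eq_mul, map_zero, Finsupp.zero_apply,
      mul_eq_zero, haj, false_or] at hk
    simpa using hk
  have hmem : d (b j) ∈ Submodule.span R ((fun i => d (b i)) '' (T.erase j : Finset ι)) := by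
    rw [← Finset.add_sum_erase T _ hjT, hej, one_smul] at hsum
    rw [eq_neg_of_add_eq_zero_left hsum]
    refine neg_mem (sum_mem fun i hi => Submodule.smul_mem _ _ (Submodule.subset_span ?_))
    exact ⟨i, hi, rfl⟩
  have hspan' : T.erase j ∈ good := by
    refine Finset.mem_filter.2 ⟨Finset.mem_univ _, le_antisymm ?_ ?_⟩
    · rw [← hspan]
      exact Submodule.span_mono (Set.image_mono (by exact_mod_cast Finset.erase_subset j T))
    · rw [← hspan, Submodule.span_le]
      rintro _ ⟨i, hi, rfl⟩
      by_cases hij : i = j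
      · subst hij; exact hmem
      · exact Submodule.subset_span ⟨i, by simpa [hij] using hi, rfl⟩
  have := hmin _ hspan'
  have := Finset.card_erase_lt_of_mem hjT
  omega

/-- Over a graded valuation ring, a homogeneous map `d` of graded free modules has kernel a
graded direct summand: there is a homogeneous projection `q` with the same kernel as `d`. -/
theorem exists_projection (hA : IsGradedValuationRing 𝒜) (hP : IsGradedBasis 𝒜 P b δ)
    (hQ : IsGradedBasis 𝒜 Q c ε) {d : M →ₗ[R] N} {w : ℤ × ℤ}
    (hd : ∀ i, d (b i) ∈ Q (δ i + w)) : ∃ q : M →ₗ[R] M,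
      (∀ y, d (q y) = d y) ∧ (∀ y, d y = 0 → q y = 0) ∧ ∀ n y, y ∈ P n → q y ∈ P n := by
  classical
  obtain ⟨T, hT, hspan⟩ := exists_linearIndepOn_map_basis hA hQ hd
  have hv : LinearIndependent R fun i : T => d (b i) := hT
  have hspan' : Submodule.span R (Set.range fun i : T => d (b i)) = LinearMap.range d := by
    rw [← hspan]
    congr 1
    ext x
    simp
  let d' : M →ₗ[R] Submodule.span R (Set.range fun i : T => d (b i)) :=
    d.codRestrict _ fun y => hspan' ▸ LinearMap.mem_range_self d y
  -- The section `d (b i) ↦ b i`, `i ∈ T`, of `d` over its image, precomposed with `d`.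
  let q : M →ₗ[R] M := (Finsupp.linearCombination R fun i : T => b i) ∘ₗ hv.repr ∘ₗ d'
  have hq : ∀ y, q y = ∑ i : T, hv.repr (d' y) i • b i := fun y => by
    simp only [q, LinearMap.comp_apply]
    rw [Finsupp.linearCombination_apply, Finsupp.sum_fintype _ _ (by simp)]
  have hdq : ∀ y, d (q y) = d y := by
    intro y
    have h := hv.linearCombination_repr (d' y)
    rw [Finsupp.linearCombination_apply, Finsupp.sum_fintype _ _ (by simp)] at h
    rw [hq, map_sum]
    simp only [map_smul]
    exact h
  have hker : ∀ y, d y = 0 → q y = 0 := by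
    intro y hy
    have : d' y = 0 := Subtype.ext hy
    simp [q, this]
  have hqb : ∀ i : T, q (b i) = b i := by
    intro i
    have h : hv.repr (d' (b i)) = Finsupp.single i 1 := hv.repr_eq_single i _ rfl
    simp [q, h]
  refine ⟨q, hdq, hker, fun n y hy => ?_⟩
  -- Homogeneity follows from uniqueness: the degree-`n` part of `q y` is fixed by `q`, being a
  -- combination of the `b i` with `i ∈ T`, and it has the same image under `d` as `y`. Hence it
  -- equals `q y`.
  have hfix : q (gradedComponent 𝒜 b δ n (q y)) = gradedComponent 𝒜 b δ n (q y) := by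
    rw [hq y, map_sum, map_sum]
    refine Finset.sum_congr rfl fun i _ => ?_
    rw [gradedComponent_smul_basis, map_smul, hqb]
  have hdy : d y ∈ Q (n + w) := hP.map_mem_of_basis hQ hd hy
  have h1 : d (gradedComponent 𝒜 b δ n (q y) - y) = 0 := by
    rw [map_sub, hQ.map_gradedComponent hd, hdq, hQ.gradedComponent_of_mem hdy, sub_self]
  have h2 := hker _ h1
  rw [map_sub, hfix, sub_eq_zero] at h2
  rw [← h2]
  exact hP.gradedComponent_mem _ _

end Section

/-! ### Tower splittings -/

/-- Either `gr₁` is even on nonzero homogeneous elements or `-1 = 1`; in both cases scalars carry no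
sign. -/
theorem IsGradedDomain.negOnePow_smul_of_mem {R : Type u} [CommRing R]
    {𝒜 : ℤ × ℤ → AddSubgroup R} [GradedRing 𝒜] (hA : IsGradedDomain 𝒜) {n : ℤ × ℤ} {r : R}
    (hr : r ∈ 𝒜 n) : (n.1.negOnePow : ℤ) • r = r := by
  by_cases h0 : r = 0
  · rw [h0, smul_zero]
  rcases hA.even_or_neg_one with h | h
  · have := (h n (fun hb => h0 (by simpa [hb] using hr))).1
    rw [Int.negOnePow_even _ this]; simp
  · rcases Int.even_or_odd n.1 with e | o
    · rw [Int.negOnePow_even _ e]; simp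
    · rw [Int.negOnePow_odd _ o]
      calc _ = (-1 : R) * r := by simp
        _ = _ := by rw [h, one_mul]

/-- A splitting of the homology of the graded complex `(M, d)` with sign involution `σ` as a
free module of rank one, generated by the class of `x`, and a module killed by `a`: the
functional `p` restricts to the projection onto the free summand, and `h` is a null-homotopy of
`a • (1 - x p)`. -/
structure TowerSplitting {R M : Type u} [CommRing R] [AddCommGroup M] [Module R M]
    (𝒜 : ℤ × ℤ → AddSubgroup R) (P : ℤ × ℤ → AddSubgroup M) (σ d : M →ₗ[R] M)
    (n : ℤ × ℤ) where
  x : M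
  p : M →ₗ[R] R
  h : M →ₗ[R] M
  a : R
  x_mem : x ∈ P n
  p_mem : ∀ {m : ℤ × ℤ} {y : M}, y ∈ P m → p y ∈ 𝒜 (m - n)
  d_x : d x = 0
  p_d : ∀ y, p (d y) = 0
  p_x : p x = 1
  sign_x : σ x = x
  p_sign : ∀ y, p (σ y) = p y
  a_ne_zero : a ≠ 0
  sign_h : ∀ y, σ (h y) = -h (σ y)
  homotopy : ∀ y, a • (y - p y • x) = d (h y) + h (d y)

theorem cycleClass_eq_zero_iff {R M : Type u} [CommRing R] [IsDomain R] [AddCommGroup M]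
    [Module R M] {d : M →ₗ[R] M} (z : LinearMap.ker d) :
    cycleClass d z = 0 ↔ ∃ a : R, a ≠ 0 ∧ ∃ y, d y = a • (z : M) := by
  change (Submodule.torsion R (Homology d)).mkQ _ = 0 ↔ _
  rw [Submodule.mkQ_apply, Submodule.Quotient.mk_eq_zero, Submodule.mem_torsion_iff]
  have key : ∀ a : R, a • ((LinearMap.range d).submoduleOf (LinearMap.ker d)).mkQ z = 0 ↔
      ∃ y, d y = a • (z : M) := by
    intro a
    rw [← map_smul, Submodule.mkQ_apply, Submodule.Quotient.mk_eq_zero]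
    rfl
  constructor
  · rintro ⟨a, ha⟩
    exact ⟨a, nonZeroDivisors.ne_zero a.2, (key a).1 ha⟩
  · rintro ⟨a, ha, hy⟩
    exact ⟨⟨a, mem_nonZeroDivisors_of_ne_zero ha⟩, (key a).2 hy⟩

namespace TowerSplitting

section

variable {R M N : Type u} [CommRing R] [AddCommGroup M] [Module R M] [AddCommGroup N]
  [Module R N] {𝒜 : ℤ × ℤ → AddSubgroup R} {P : ℤ × ℤ → AddSubgroup M}
  {Q : ℤ × ℤ → AddSubgroup N} {σ d : M →ₗ[R] M} {σ' d' : N →ₗ[R] N} {n m : ℤ × ℤ}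

/-- The homology modulo torsion of a complex with a tower splitting is free of rank one. -/
theorem exists_equiv [IsDomain R] (T : TowerSplitting 𝒜 P σ d n) :
    ∃ e : HomologyModTorsion d ≃ₗ[R] R, ∀ z, e (cycleClass d z) = T.p z := by
  let p₁ : Homology d →ₗ[R] R := ((LinearMap.range d).submoduleOf (LinearMap.ker d)).liftQ
    (T.p ∘ₗ (LinearMap.ker d).subtype) (by
      rintro ⟨z, hz⟩ ⟨y, hy⟩
      change T.p z = 0
      have : z = d y := hy.symm
      rw [this, T.p_d])
  let p₂ : HomologyModTorsion d →ₗ[R] R := (Submodule.torsion R (Homology d)).liftQ p₁ (by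
    rintro x ⟨a, ha⟩
    have h : (a : R) * p₁ x = 0 := by
      rw [← smul_eq_mul, ← map_smul]
      have h2 : (a : R) • x = 0 := ha
      rw [h2, map_zero]
    exact (mul_eq_zero.1 h).resolve_left (nonZeroDivisors.ne_zero a.2))
  have hp₂ : ∀ z, p₂ (cycleClass d z) = T.p z := fun z => rfl
  refine ⟨LinearEquiv.ofBijective p₂ ⟨?_, ?_⟩, hp₂⟩
  · rw [injective_iff_map_eq_zero]
    intro c hc
    obtain ⟨z, rfl⟩ := cycleClass_surjective d c
    rw [hp₂] at hc
    rw [cycleClass_eq_zero_iff]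
    -- For a cycle with `p z = 0` the homotopy reads `a • z = d (h z)`, so its class is torsion.
    refine ⟨T.a, T.a_ne_zero, T.h z, ?_⟩
    have := T.homotopy z
    rw [hc, zero_smul, sub_zero, LinearMap.mem_ker.1 z.2, map_zero, add_zero] at this
    exact this.symm
  · intro r
    refine ⟨cycleClass d ⟨r • T.x, by simp [T.d_x]⟩, ?_⟩
    rw [hp₂]
    simp [T.p_x]

/-- A chain map induces an isomorphism on homology modulo torsion exactly if it maps a
generator to a generator. -/
theorem bijective_iff [IsDomain R] (T : TowerSplitting 𝒜 P σ d n)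
    (T' : TowerSplitting 𝒜 Q σ' d' m) (f : M →ₗ[R] N) (h : f ∘ₗ d = d' ∘ₗ f) :
    Function.Bijective (homologyModTorsionMap f h) ↔ IsUnit (T'.p (f T.x)) := by
  obtain ⟨e, he⟩ := T.exists_equiv
  obtain ⟨e', he'⟩ := T'.exists_equiv
  have hf : ∀ y, f (d y) = d' (f y) := fun y => LinearMap.congr_fun h y
  have key : ∀ c, e' (homologyModTorsionMap f h c) = e c * T'.p (f T.x) := by
    intro c
    obtain ⟨z, rfl⟩ := cycleClass_surjective d c
    rw [homologyModTorsionMap_cycleClass, he, he']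
    change T'.p (f z) = _
    -- Apply `p' ∘ f` to the homotopy at the cycle `z`. The boundary term dies and `a` cancels,
    -- leaving `p' (f z) = p z * p' (f x)`: the induced map is multiplication by `p' (f x)`.
    have h1 := congrArg (fun y => T'.p (f y)) (T.homotopy z)
    simp only [LinearMap.mem_ker.1 z.2, map_zero, add_zero, hf, T'.p_d, map_smul, map_sub,
      smul_eq_mul, mul_eq_zero, T.a_ne_zero, false_or] at h1
    exact sub_eq_zero.1 h1
  constructor
  · intro hb
    obtain ⟨c, hc⟩ := hb.2 (e'.symm 1)
    have := key c
    rw [hc, LinearEquiv.apply_symm_apply] at this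
    exact IsUnit.of_mul_eq_one (e c) (by rw [mul_comm]; exact this.symm)
  · intro hu
    constructor
    · intro c c' hcc
      have := congrArg e' hcc
      rw [key, key] at this
      exact e.injective (hu.mul_left_injective this)
    · intro c
      obtain ⟨v, hv⟩ := hu.exists_right_inv
      refine ⟨e.symm (e' c * v), e'.injective ?_⟩
      rw [key, LinearEquiv.apply_symm_apply, mul_assoc, mul_comm v, hv, mul_one]

/-- Transport of a tower splitting along an isomorphism. -/
def congr (T : TowerSplitting 𝒜 P σ d n) (e : M ≃ₗ[R] N) (hσ : ∀ y, e (σ y) = σ' (e y))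
    (hd : ∀ y, e (d y) = d' (e y)) (hP : ∀ k y, y ∈ P k → e y ∈ Q k)
    (hQ : ∀ k y, y ∈ Q k → e.symm y ∈ P k) : TowerSplitting 𝒜 Q σ' d' n where
  x := e T.x
  p := T.p ∘ₗ e.symm.toLinearMap
  h := e.toLinearMap ∘ₗ T.h ∘ₗ e.symm.toLinearMap
  a := T.a
  x_mem := hP _ _ T.x_mem
  p_mem := fun hy => T.p_mem (hQ _ _ hy)
  d_x := by rw [← hd, T.d_x, map_zero]
  p_d := fun y => by
    obtain ⟨y, rfl⟩ := e.surjective y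
    simp [← hd, T.p_d]
  p_x := by simp [T.p_x]
  sign_x := by rw [← hσ, T.sign_x]
  p_sign := fun y => by
    obtain ⟨y, rfl⟩ := e.surjective y
    simp [← hσ, T.p_sign]
  a_ne_zero := T.a_ne_zero
  sign_h := fun y => by
    obtain ⟨y, rfl⟩ := e.surjective y
    simp [← hσ, T.sign_h]
  homotopy := fun y => by
    obtain ⟨y, rfl⟩ := e.surjective y
    simpa [← hd] using congrArg e (T.homotopy y)

/-- The tensor product of two tower splittings. -/
noncomputable def tensor [IsDomain R] [SetLike.GradedMonoid 𝒜] (T : TowerSplitting 𝒜 P σ d n)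
    (T' : TowerSplitting 𝒜 Q σ' d' m) :
    TowerSplitting 𝒜 (tensorGrading (A := R) P Q) (TensorProduct.map σ σ')
      (TensorProduct.map d LinearMap.id + TensorProduct.map σ d') (n + m) where
  x := T.x ⊗ₜ T'.x
  p := LinearMap.mul' R R ∘ₗ TensorProduct.map T.p T'.p
  -- The homotopy for the telescoping `1 - xp ⊗ x'p' = (1 - xp) ⊗ 1 + xp ⊗ (1 - x'p')`, scaled by `a
  -- a'`. The second term needs no sign because `σ x = x` and `p σ = p`.
  h := T'.a • TensorProduct.map T.h LinearMap.id +
    T.a • TensorProduct.map (T.p.smulRight T.x) T'.h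
  a := T.a * T'.a
  x_mem := AddSubgroup.subset_closure ⟨_, _, _, _, T.x_mem, T'.x_mem, rfl, rfl⟩
  p_mem := by
    intro k y hy
    induction hy using AddSubgroup.closure_induction with
    | mem y hy =>
      obtain ⟨i, j, y, z, hy, hz, rfl, rfl⟩ := hy
      have := SetLike.GradedMul.mul_mem (T.p_mem hy) (T'.p_mem hz)
      rw [add_sub_add_comm]
      simpa using this
    | zero => rw [map_zero]; exact zero_mem _
    | add y z _ _ hy hz => rw [map_add]; exact add_mem hy hz
    | neg y _ hy => rw [map_neg]; exact neg_mem hy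
  d_x := by simp [T.d_x, T'.d_x]
  p_d := fun y => by
    induction y using TensorProduct.induction_on with
    | zero => simp
    | tmul y z => simp [T.p_d, T'.p_d]
    | add y z hy hz => rw [map_add, map_add, hy, hz, add_zero]
  p_x := by simp [T.p_x, T'.p_x]
  sign_x := by simp [T.sign_x, T'.sign_x]
  p_sign := fun y => by
    induction y using TensorProduct.induction_on with
    | zero => simp
    | tmul y z => simp [T.p_sign, T'.p_sign]
    | add y z hy hz => rw [map_add, map_add, hy, hz, map_add]
  a_ne_zero := mul_ne_zero T.a_ne_zero T'.a_ne_zero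
  sign_h := fun y => by
    induction y using TensorProduct.induction_on with
    | zero => simp
    | tmul y z =>
      simp [T.sign_h, T'.sign_h, T.p_sign, T.sign_x, TensorProduct.neg_tmul,
        TensorProduct.tmul_neg]
      abel
    | add y z hy hz => simp only [map_add, hy, hz, neg_add]
  homotopy := fun y => by
    induction y using TensorProduct.induction_on with
    | zero => simp
    | tmul y z =>
      have e1 := congrArg (fun v => v ⊗ₜ[R] z) (T.homotopy y)
      have e2 := congrArg (fun v => T.x ⊗ₜ[R] v) (T'.homotopy z)
      simp only [TensorProduct.tmul_smul, TensorProduct.sub_tmul,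
        TensorProduct.tmul_sub, TensorProduct.add_tmul, TensorProduct.tmul_add,
        ← TensorProduct.smul_tmul'] at e1 e2
      -- The cross terms `σ h ⊗ d'` and `h σ ⊗ d'` cancel since `h` anticommutes with `σ`.
      simp [T.d_x, T.p_d, T.p_sign, T.sign_x, T.sign_h, TensorProduct.neg_tmul,
        ← TensorProduct.smul_tmul']
      linear_combination (norm := module) T'.a • e1 + (T.a * T.p y) • e2
    | add y z hy hz =>
      simp only [map_add] at hy hz ⊢
      rw [add_add_add_comm, ← hy, ← hz, ← smul_add, add_smul]
      congr 1
      abel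

end

end TowerSplitting

/-- The grading on the dual module: a functional has degree `n` if it raises degrees by `n`. -/
def dualGrading {R M : Type u} [CommRing R] [AddCommGroup M] [Module R M]
    (𝒜 : ℤ × ℤ → AddSubgroup R) (P : ℤ × ℤ → AddSubgroup M) (n : ℤ × ℤ) :
    AddSubgroup (Module.Dual R M) where
  carrier := {φ | ∀ m y, y ∈ P m → φ y ∈ 𝒜 (m + n)}
  zero_mem' := fun _ _ _ => zero_mem _
  add_mem' := fun hφ hψ m y hy => add_mem (hφ m y hy) (hψ m y hy)
  neg_mem' := fun hφ m y hy => neg_mem (hφ m y hy)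

/-- The dual of a tower splitting. -/
noncomputable def TowerSplitting.dual {R M : Type u} [CommRing R] [AddCommGroup M] [Module R M]
    {𝒜 : ℤ × ℤ → AddSubgroup R} {P : ℤ × ℤ → AddSubgroup M} {σ d : M →ₗ[R] M} {n : ℤ × ℤ}
    (T : TowerSplitting 𝒜 P σ d n) (hσ : ∀ y, σ (σ y) = y) (hσd : ∀ y, σ (d y) = -d (σ y)) :
    TowerSplitting 𝒜 (dualGrading 𝒜 P) σ.dualMap (d ∘ₗ σ).dualMap (-n) where
  x := T.p
  p := Module.Dual.eval R M T.x
  -- Moving `σ` past `d` or `h` in `h σ d σ` and `d σ h σ` costs a sign, which the minus here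
  -- absorbs.
  h := -(T.h ∘ₗ σ).dualMap
  a := T.a
  x_mem := fun m y hy => by rw [← sub_eq_add_neg]; exact T.p_mem hy
  p_mem := fun {m φ} hφ => by
    have := hφ _ _ T.x_mem
    rwa [sub_neg_eq_add, add_comm]
  d_x := LinearMap.ext fun y => T.p_d _
  p_d := fun φ => by simp [T.sign_x, T.d_x]
  p_x := T.p_x
  sign_x := LinearMap.ext fun y => T.p_sign _
  p_sign := fun φ => by simp [T.sign_x]
  a_ne_zero := T.a_ne_zero
  sign_h := fun φ => by
    ext y
    simp [T.sign_h, hσ]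
  homotopy := fun φ => by
    ext y
    have := congrArg φ (T.homotopy y)
    simp [T.sign_h, hσd, hσ] at this ⊢
    rw [mul_comm (φ T.x), this, add_comm]

/-! ### Existence of tower splittings over a graded valuation ring -/

section Existence

variable {ι : Type*} {R M : Type u} [CommRing R] [AddCommGroup M] [Module R M] [Fintype ι]
  {𝒜 : ℤ × ℤ → AddSubgroup R} [GradedRing 𝒜] {P : ℤ × ℤ → AddSubgroup M}
  {b : Module.Basis ι R M} {δ : ι → ℤ × ℤ} {σ d : M →ₗ[R] M}

/-- Over a graded valuation ring, a complex whose homology modulo torsion is free of rank one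
has a tower splitting. -/
theorem exists_towerSplitting (hA : IsGradedValuationRing 𝒜) (hP : IsGradedBasis 𝒜 P b δ)
    (hd : ∀ {n y}, y ∈ P n → d y ∈ P (n - (1, 1))) (hdd : ∀ y, d (d y) = 0)
    (hσ : ∀ {n y}, y ∈ P n → σ y = (n.1.negOnePow : ℤ) • y)
    (e : HomologyModTorsion d ≃ₗ[R] R) (w : ℤ × ℤ)
    (he : ∀ (n : ℤ × ℤ) (z : LinearMap.ker d), (z : M) ∈ P n → e (cycleClass d z) ∈ 𝒜 (n + w))
    (hw : P (-w) ≠ ⊥ → Even w.1) :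
    ∃ T : TowerSplitting 𝒜 P σ d (-w), ∀ z, e (cycleClass d z) = T.p z := by
  classical
  have _ := hA.isDomain
  have hd' : ∀ i, d (b i) ∈ P (δ i + -(1, 1)) := fun i => by
    rw [← sub_eq_add_neg]; exact hd (hP.basis_mem i)
  obtain ⟨q, hdq, hker, hq⟩ := exists_projection hA hP hP hd'
  -- The projection onto cycles; it extends the functional `e ∘ cycleClass` from cycles to all of
  -- `M`.
  let π : M →ₗ[R] LinearMap.ker d := (LinearMap.id - q).codRestrict _ fun y => by
    simp [hdq]
  have hπ : ∀ y, (π y : M) = y - q y := fun y => rfl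
  let p : M →ₗ[R] R := e.toLinearMap ∘ₗ cycleClass d ∘ₗ π
  have hpe : ∀ z : LinearMap.ker d, e (cycleClass d z) = p z := by
    intro z
    have : π z = z := Subtype.ext (by rw [hπ, hker _ z.2, sub_zero])
    simp [p, this]
  have hp_mem : ∀ {m y}, y ∈ P m → p y ∈ 𝒜 (m + w) := fun {m y} hy =>
    he m (π y) (by rw [hπ]; exact sub_mem hy (hq _ _ hy))
  have hp_basis : ∀ i, p (b i) ∈ 𝒜 (δ i + w) := fun i => hp_mem (hP.basis_mem i)
  have hpd : ∀ y, p (d y) = 0 := by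
    intro y
    have h := hpe ⟨d y, hdd y⟩
    rw [(cycleClass_eq_zero_iff _).2 ⟨1, one_ne_zero, y, by simp⟩, map_zero] at h
    exact h.symm
  obtain ⟨z, hz⟩ : ∃ z : LinearMap.ker d, p z = 1 := by
    obtain ⟨z, hz⟩ := cycleClass_surjective d (e.symm 1)
    exact ⟨z, by rw [← hpe, hz, LinearEquiv.apply_symm_apply]⟩
  -- Any cycle with `p z = 1` may be replaced by its degree `-w` part: `d` and `p` are homogeneous
  -- and `1` has degree zero.
  let x : M := gradedComponent 𝒜 b δ (-w) z
  have hx_mem : x ∈ P (-w) := hP.gradedComponent_mem _ _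
  have hdx : d x = 0 := by
    rw [hP.map_gradedComponent hd', LinearMap.mem_ker.1 z.2, map_zero]
  have hpx : p x = 1 := by
    rw [← IsGradedBasis.decompose_map hp_basis, hz, neg_add_cancel]
    exact DirectSum.decompose_of_mem_same _ SetLike.GradedOne.one_mem
  have hw' : Even w.1 := hw fun h => by
    rw [h, AddSubgroup.mem_bot] at hx_mem
    rw [hx_mem, map_zero] at hpx
    exact zero_ne_one hpx
  have hσx : σ x = x := by
    rw [hσ hx_mem, Prod.fst_neg, Int.negOnePow_even _ hw'.neg]
    simp
  have hpσ : ∀ y, p (σ y) = p y := by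
    intro y
    suffices p ∘ₗ σ = p from LinearMap.congr_fun this y
    refine b.ext fun i => ?_
    have h := hA.negOnePow_smul_of_mem (hp_basis i)
    rw [Prod.fst_add, Int.negOnePow_add, Int.negOnePow_even _ hw', mul_one] at h
    rw [LinearMap.comp_apply, hσ (hP.basis_mem i), map_zsmul, h]
  have hσd : ∀ y, σ (d y) = -d (σ y) := by
    intro y
    suffices σ ∘ₗ d = -(d ∘ₗ σ) from LinearMap.congr_fun this y
    refine b.ext fun i => ?_
    have hb := hP.basis_mem i
    rw [LinearMap.comp_apply, LinearMap.neg_apply, LinearMap.comp_apply, hσ (hd hb), hσ hb,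
      map_zsmul, Prod.fst_sub, Int.negOnePow_sub, Int.negOnePow_one]
    simp
  have hσq : ∀ y, σ (q y) = q (σ y) := by
    intro y
    suffices σ ∘ₗ q = q ∘ₗ σ from LinearMap.congr_fun this y
    refine b.ext fun i => ?_
    have hb := hP.basis_mem i
    rw [LinearMap.comp_apply, LinearMap.comp_apply, hσ (hq _ _ hb), hσ hb, map_zsmul]
  -- The cycle part of `b i`, corrected by a multiple of `x`, is killed by `p`; its class vanishes
  -- modulo torsion, so a nonzero multiple bounds.
  have htor : ∀ i, ∃ a : R, a ≠ 0 ∧ ∃ y, d y = a • (b i - q (b i) - p (b i) • x) := by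
    intro i
    have hc : d (b i - q (b i) - p (b i) • x) = 0 := by simp [hdq, hdx]
    have h := hpe ⟨_, hc⟩
    refine (cycleClass_eq_zero_iff ⟨_, hc⟩).1 (e.injective ?_)
    have hpq : p (q (b i)) = 0 := by
      have : π (q (b i)) = 0 := Subtype.ext (by
        rw [hπ, ← map_sub, hker _ (by rw [map_sub, hdq, sub_self])]; rfl)
      simp [p, this]
    rw [h, map_zero]
    simp [hpq, hpx]
  choose a ha y hy using htor
  -- A common multiple of the finitely many torsion witnesses, so that one scalar serves for all
  -- basis vectors.
  let A : R := ∏ i, a i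
  have hA0 : A ≠ 0 := Finset.prod_ne_zero_iff.2 fun i _ => ha i
  have hdvd : ∀ i, a i ∣ A := fun i => Finset.dvd_prod_of_mem a (Finset.mem_univ i)
  choose c hc using hdvd
  let Y : M →ₗ[R] M := b.constr R fun i => c i • y i
  have hdY : ∀ v, d (Y v) = A • (v - q v - p v • x) := by
    intro v
    suffices d ∘ₗ Y = A • (LinearMap.id - q - p.smulRight x) from LinearMap.congr_fun this v
    refine b.ext fun i => ?_
    simp only [LinearMap.comp_apply, Y, Module.Basis.constr_basis, map_smul, hy, smul_smul]
    rw [mul_comm, ← hc]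
    rfl
  have hqq : ∀ {u v}, d u = d v → q u = q v := fun {u v} h => by
    rw [← sub_eq_zero, ← map_sub]
    exact hker _ (by rw [map_sub, h, sub_self])
  -- By `hdY`, `Y` accounts only for the cycle part `1 - q`. Since `q u` depends only on `d u`,
  -- replacing `Y` by `q ∘ Y` makes `h (d v)` computable: `d (Y (d v)) = d (A • v)`, hence `q (Y (d
  -- v)) = A • q v`, the missing summand. The same uniqueness gives anticommutation with `σ`,
  -- although `Y` need not be homogeneous.
  refine ⟨{ x := x, p := p, h := q ∘ₗ Y, a := A, x_mem := hx_mem,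
            p_mem := fun hy => by rw [sub_neg_eq_add]; exact hp_mem hy,
            d_x := hdx, p_d := hpd, p_x := hpx, sign_x := hσx, p_sign := hpσ, a_ne_zero := hA0,
            sign_h := fun v => ?_, homotopy := fun v => ?_ }, hpe⟩
  · rw [LinearMap.comp_apply, LinearMap.comp_apply, hσq, ← map_neg]
    apply hqq
    rw [← neg_eq_iff_eq_neg.2 (hσd (Y v)), map_neg, hdY, hdY]
    simp only [map_smul, map_sub, hσq, hσx, hpσ]
  · change A • (v - p v • x) = d (q (Y v)) + q (Y (d v))
    rw [hdq, hdY]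
    have : q (Y (d v)) = q (A • v) := hqq (by
      rw [hdY, hker _ (hdd v), hpd]; simp)
    rw [this, map_smul, ← smul_add]
    congr 1
    abel

end Existence

/-- An additive map sends a piece of a tensor grading into any subgroup containing the images
of its generators. -/
theorem map_mem_of_tensorGrading {A M N M' : Type u} [CommRing A] [AddCommGroup M]
    [AddCommGroup N] [Module A M] [Module A N] [AddCommGroup M'] {P : ℤ × ℤ → AddSubgroup M}
    {Q : ℤ × ℤ → AddSubgroup N} {n : ℤ × ℤ} {H : AddSubgroup M'} (F : M ⊗[A] N →+ M')
    (hF : ∀ p q x y, x ∈ P p → y ∈ Q q → p + q = n → F (x ⊗ₜ y) ∈ H) {t : M ⊗[A] N}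
    (ht : t ∈ tensorGrading (A := A) P Q n) : F t ∈ H := by
  have : tensorGrading (A := A) P Q n ≤ H.comap F := by
    rw [tensorGrading, AddSubgroup.closure_le]
    rintro _ ⟨p, q, x, y, hx, hy, h, rfl⟩
    exact hF p q x y hx hy h
  exact this ht

theorem tmul_mem_tensorGrading {A M N : Type u} [CommRing A] [AddCommGroup M]
    [AddCommGroup N] [Module A M] [Module A N] {P : ℤ × ℤ → AddSubgroup M}
    {Q : ℤ × ℤ → AddSubgroup N} {p q : ℤ × ℤ} {x : M} {y : N} (hx : x ∈ P p) (hy : y ∈ Q q) :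
    x ⊗ₜ[A] y ∈ tensorGrading (A := A) P Q (p + q) :=
  AddSubgroup.subset_closure ⟨p, q, x, y, hx, hy, rfl, rfl⟩

/-! ### Base change of complexes and the tower conditions -/

namespace GridDatum

variable {G : GridDatum.{u}}

noncomputable instance gradedRing : GradedRing G.gr where
  toDecomposition := isInternal_gr.chooseDecomposition

/-- A grading of an algebra over the grid ring is compatible with the grading of the grid ring
if the structure map preserves degrees. -/
def IsGradedAlgebra {R : Type u} [CommRing R] [Algebra G.S R] (𝒜 : ℤ × ℤ → AddSubgroup R) :
    Prop :=
  ∀ (n : ℤ × ℤ) (s : G.S), s ∈ G.gr n → algebraMap G.S R s ∈ 𝒜 n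

theorem isGradedAlgebra_grU : IsGradedAlgebra (G := G) G.grU := fun _ _ hs => hs.1

theorem isGradedAlgebra_grV : IsGradedAlgebra (G := G) G.grV := fun _ _ hs => hs.2

end GridDatum

namespace SComplex

variable {G : GridDatum.{u}}

theorem exists_isGradedBasis (C : SComplex G) :
    ∃ (r : ℕ) (b : Module.Basis (Fin r) G.S C.carrier) (δ : Fin r → ℤ × ℤ),
      IsGradedBasis G.gr C.gr b δ := by
  obtain ⟨r, b, δ, hb⟩ := C.exists_basis
  exact ⟨r, b, δ, C.mem_gr_iff_repr b δ hb⟩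

theorem sign_sign (C : SComplex G) (x : C.carrier) : C.sign (C.sign x) = x := by
  refine induction_homogeneous C.isInternal (p := fun x => C.sign (C.sign x) = x) (by simp) ?_ ?_ x
  · intro n x hx
    rw [C.sign_of_mem hx, map_zsmul, C.sign_of_mem hx, smul_smul, ← Units.val_mul,
      Int.units_mul_self, Units.val_one, one_smul]
  · intro x y hx hy
    rw [map_add, map_add, hx, hy]

section BaseChange

variable {R : Type u} [CommRing R] [Algebra G.S R] {𝒜 : ℤ × ℤ → AddSubgroup R} [GradedRing 𝒜]
  (C D : SComplex G)

/-- Brings base changes of complexes within reach of the results on graded bases over a valuation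
ring. -/
theorem isGradedBasis_baseChange (hS : GridDatum.IsGradedAlgebra (G := G) 𝒜) {r : ℕ}
    {b : Module.Basis (Fin r) G.S C.carrier} {δ : Fin r → ℤ × ℤ}
    (hb : IsGradedBasis G.gr C.gr b δ) :
    IsGradedBasis 𝒜 (tensorGrading (A := G.S) 𝒜 C.gr) (b.baseChange R) δ := by
  intro n x
  constructor
  · intro hx i
    refine map_mem_of_tensorGrading ((b.baseChange R).coord i).toAddMonoidHom ?_ hx
    rintro p q y z hy hz rfl
    have h := SetLike.GradedMul.mul_mem (hS _ _ ((hb q z).1 hz i)) hy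
    have e : q - δ i + p = p + q - δ i := by abel
    rw [e] at h
    simpa [Algebra.smul_def] using h
  · intro h
    rw [← (b.baseChange R).sum_repr x]
    refine sum_mem fun i _ => ?_
    have h1 := tmul_mem_tensorGrading (A := G.S) (h i) (hb.basis_mem i)
    rw [sub_add_cancel] at h1
    simpa [TensorProduct.smul_tmul'] using h1

theorem baseChange_d_mem {n : ℤ × ℤ} {y : R ⊗[G.S] C.carrier}
    (hy : y ∈ tensorGrading (A := G.S) 𝒜 C.gr n) :
    C.d.baseChange R y ∈ tensorGrading (A := G.S) 𝒜 C.gr (n - (1, 1)) := by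
  refine map_mem_of_tensorGrading (C.d.baseChange R).toAddMonoidHom ?_ hy
  rintro p q r c hr hc rfl
  rw [add_sub_assoc]
  exact tmul_mem_tensorGrading hr (C.d_mem hc)

theorem baseChange_d_d (y : R ⊗[G.S] C.carrier) :
    C.d.baseChange R (C.d.baseChange R y) = 0 := by
  rw [← LinearMap.comp_apply, ← LinearMap.baseChange_comp, C.d_comp_d, LinearMap.baseChange_zero,
    LinearMap.zero_apply]

/-- In `r ⊗ c` the sign of `r` acts trivially, so the sign of `c` alone is already the sign of the
total degree. -/
theorem baseChange_sign_of_mem (hA : IsGradedDomain 𝒜) {n : ℤ × ℤ} {y : R ⊗[G.S] C.carrier}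
    (hy : y ∈ tensorGrading (A := G.S) 𝒜 C.gr n) :
    C.sign.baseChange R y = (n.1.negOnePow : ℤ) • y := by
  rw [← sub_eq_zero, ← AddSubgroup.mem_bot]
  refine map_mem_of_tensorGrading ((C.sign.baseChange R).toAddMonoidHom -
    (n.1.negOnePow : ℤ) • AddMonoidHom.id _) ?_ hy
  rintro p q r c hr hc rfl
  rw [AddSubgroup.mem_bot]
  change C.sign.baseChange R (r ⊗ₜ[G.S] c) - ((p + q).1.negOnePow : ℤ) • (r ⊗ₜ[G.S] c) = 0
  rw [LinearMap.baseChange_tmul, C.sign_of_mem hc, Prod.fst_add, Int.negOnePow_add,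
    Units.val_mul, mul_comm, mul_smul, TensorProduct.smul_tmul', hA.negOnePow_smul_of_mem hr,
    TensorProduct.tmul_smul, sub_self]

/-- Restricts the degree in which a tower generator can live. A nonzero coordinate of degree `n - δ
i` and the nonzero basis vector of degree `δ i` each satisfy the congruence. -/
theorem baseChange_parity (hA : IsGradedDomain 𝒜) (hS : GridDatum.IsGradedAlgebra (G := G) 𝒜)
    {n : ℤ × ℤ} (hn : tensorGrading (A := G.S) 𝒜 C.gr n ≠ ⊥) : n.1 ≡ n.2 [ZMOD 2] := by
  have _ := hA.isDomain
  obtain ⟨r, b, δ, hb⟩ := C.exists_isGradedBasis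
  obtain ⟨⟨y, hy⟩, hy0'⟩ := AddSubgroup.ne_bot_iff_exists_ne_zero.1 hn
  have hy0 : y ≠ 0 := fun h => hy0' (Subtype.ext h)
  obtain ⟨i, hi⟩ : ∃ i, (b.baseChange R).repr y i ≠ 0 := by
    by_contra! h
    exact hy0 ((b.baseChange R).repr.injective (Finsupp.ext (by simpa using h)))
  have h1 := hA.parity (n - δ i) fun h => hi (by
    simpa [h] using (C.isGradedBasis_baseChange hS hb n y).1 hy i)
  have h2 := C.parity (δ i) fun h => by
    have hb0 : b i = 0 := by simpa [h] using hb.basis_mem i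
    apply hi
    have : (b.baseChange R) i = 0 := by simp [hb0]
    have h3 : (1 : R) = 0 := by
      simpa [this] using congrArg (fun v => v i) ((b.baseChange R).repr_self i).symm
    exact absurd h3 one_ne_zero
  simpa using h1.add h2

variable (𝒜) in
/-- A tower splitting of the base change of a complex. -/
abbrev TowerOver (n : ℤ × ℤ) : Type u :=
  TowerSplitting 𝒜 (tensorGrading (A := G.S) 𝒜 C.gr) (C.sign.baseChange R) (C.d.baseChange R) n

variable (𝒜) in
/-- The common form of the two tower conditions. -/
def HasTower (w : ℤ →+ ℤ × ℤ) : Prop :=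
  ∃ (e : HomologyModTorsion (C.d.baseChange R) ≃ₗ[R] R) (j : ℤ),
    ∀ (n : ℤ × ℤ) (z : LinearMap.ker (C.d.baseChange R)),
      (z : R ⊗[G.S] C.carrier) ∈ tensorGrading (A := G.S) 𝒜 C.gr n →
        e (cycleClass _ z) ∈ 𝒜 (n + w j)

variable {C} in
-- Passes between the homological and the chain-level form of a tower. The isomorphism shifts
-- degrees by the negative of the degree of the generator. The condition on `w` ensures that the
-- generator has even `gr₁`, so the sign involution fixes it.
theorem hasTower_iff (hA : IsGradedValuationRing 𝒜)
    (hS : GridDatum.IsGradedAlgebra (G := G) 𝒜) {w : ℤ →+ ℤ × ℤ}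
    (hw : ∀ j, (w j).1 ≡ (w j).2 [ZMOD 2] → Even (w j).1) :
    C.HasTower 𝒜 w ↔ ∃ j, Nonempty (C.TowerOver 𝒜 (w j)) := by
  have _ := hA.isDomain
  constructor
  · rintro ⟨e, j, he⟩
    obtain ⟨r, b, δ, hb⟩ := C.exists_isGradedBasis
    obtain ⟨T, -⟩ := exists_towerSplitting hA (C.isGradedBasis_baseChange hS hb)
      C.baseChange_d_mem C.baseChange_d_d (C.baseChange_sign_of_mem hA.toIsGradedDomain) e (w j) he
      fun h => hw j (by simpa using (C.baseChange_parity hA.toIsGradedDomain hS h).neg)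
    exact ⟨-j, ⟨by rw [map_neg]; exact T⟩⟩
  · rintro ⟨j, ⟨T⟩⟩
    obtain ⟨e, he⟩ := T.exists_equiv
    refine ⟨e, -j, fun n z hz => ?_⟩
    rw [he, map_neg, ← sub_eq_add_neg]
    exact T.p_mem hz

end BaseChange

/-- The second coordinate is zero, so the congruence says that `j` is even. -/
theorem even_inl (j : ℤ) (h : (AddMonoidHom.inl ℤ ℤ j).1 ≡ (AddMonoidHom.inl ℤ ℤ j).2 [ZMOD 2]) :
    Even (AddMonoidHom.inl ℤ ℤ j).1 :=
  Int.even_iff.2 h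

theorem even_inr (j : ℤ) (_ : (AddMonoidHom.inr ℤ ℤ j).1 ≡ (AddMonoidHom.inr ℤ ℤ j).2 [ZMOD 2]) :
    Even (AddMonoidHom.inr ℤ ℤ j).1 :=
  ⟨0, rfl⟩

theorem isLeftKnotlike_iff {C : SComplex G} :
    C.IsLeftKnotlike ↔ ∃ j : ℤ, Nonempty (C.TowerOver G.grU (j, 0)) :=
  hasTower_iff (w := AddMonoidHom.inl ℤ ℤ) G.typeZeroU.toIsGradedValuationRing
    GridDatum.isGradedAlgebra_grU even_inl

theorem isRightKnotlike_iff {C : SComplex G} :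
    C.IsRightKnotlike ↔ ∃ j : ℤ, Nonempty (C.TowerOver G.grV (0, j)) :=
  hasTower_iff (w := AddMonoidHom.inr ℤ ℤ) G.typeZeroV.toIsGradedValuationRing
    GridDatum.isGradedAlgebra_grV even_inr

end SComplex

namespace SComplex

variable {G : GridDatum.{u}}

/-! ### Products of knotlike complexes -/

theorem sign_unique (C : SComplex G) (F : C.carrier →ₗ[G.S] C.carrier)
    (hF : ∀ n x, x ∈ C.gr n → F x = (n.1.negOnePow : ℤ) • x) : C.sign = F := by
  refine LinearMap.ext fun t => ?_
  refine induction_homogeneous C.isInternal (p := fun t => C.sign t = F t)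
    (by simp) ?_ (fun x y hx hy => by rw [map_add, map_add, hx, hy]) t
  intro n x hx
  rw [sign_of_mem _ hx, hF _ _ hx]

theorem sign_tensor (C D : SComplex G) :
    (tensor C D).sign = TensorProduct.map C.sign D.sign := by
  refine sign_unique (tensor C D) (TensorProduct.map C.sign D.sign) ?_
  intro n (x : C.carrier ⊗[G.S] D.carrier) hx
  change TensorProduct.map C.sign D.sign x = (n.1.negOnePow : ℤ) • x
  rw [← sub_eq_zero, ← AddSubgroup.mem_bot]
  refine map_mem_of_tensorGrading ((TensorProduct.map C.sign D.sign).toAddMonoidHom -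
    (n.1.negOnePow : ℤ) • AddMonoidHom.id _) ?_ hx
  rintro p q c d hc hd rfl
  rw [AddSubgroup.mem_bot]
  change TensorProduct.map C.sign D.sign (c ⊗ₜ[G.S] d) -
    ((p + q).1.negOnePow : ℤ) • (c ⊗ₜ[G.S] d) = 0
  rw [TensorProduct.map_tmul, C.sign_of_mem hc, D.sign_of_mem hd, Prod.fst_add,
    Int.negOnePow_add, Units.val_mul, mul_smul, ← TensorProduct.smul_tmul',
    TensorProduct.tmul_smul, sub_self]

section

variable {R : Type u} [CommRing R] [Algebra G.S R] {𝒜 : ℤ × ℤ → AddSubgroup R} [GradedRing 𝒜]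
  {C D : SComplex G} {n m : ℤ × ℤ}

theorem distribBaseChange_symm_mem {k : ℤ × ℤ}
    {y : (R ⊗[G.S] C.carrier) ⊗[R] (R ⊗[G.S] D.carrier)}
    (hy : y ∈ tensorGrading (A := R) (tensorGrading (A := G.S) 𝒜 C.gr)
      (tensorGrading (A := G.S) 𝒜 D.gr) k) :
    (TensorProduct.AlgebraTensorModule.distribBaseChange G.S R C.carrier D.carrier).symm y ∈
      tensorGrading (A := G.S) 𝒜 (tensorGrading (A := G.S) C.gr D.gr) k := by
  let Φ := (TensorProduct.AlgebraTensorModule.distribBaseChange G.S R C.carrier D.carrier).symm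
  refine map_mem_of_tensorGrading (Φ : _ ≃ₗ[R] _).toLinearMap.toAddMonoidHom ?_ hy
  rintro p q x z hx hz rfl
  refine map_mem_of_tensorGrading
    ((Φ : _ ≃ₗ[R] _).toLinearMap.toAddMonoidHom.comp
      (((TensorProduct.mk R _ _).flip z).toAddMonoidHom)) ?_ hx
  rintro p₁ p₂ r c hr hc rfl
  refine map_mem_of_tensorGrading
    ((Φ : _ ≃ₗ[R] _).toLinearMap.toAddMonoidHom.comp
      ((TensorProduct.mk R _ _ (r ⊗ₜ c)).toAddMonoidHom)) ?_ hz
  rintro q₁ q₂ s d hs hd rfl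
  change Φ ((r ⊗ₜ c) ⊗ₜ (s ⊗ₜ d)) ∈ _
  rw [TensorProduct.AlgebraTensorModule.distribBaseChange_symm_tmul, add_add_add_comm]
  exact tmul_mem_tensorGrading (SetLike.GradedMul.mul_mem hr hs) (tmul_mem_tensorGrading hc hd)

theorem distribBaseChange_mem {k : ℤ × ℤ} {y : R ⊗[G.S] (C.carrier ⊗[G.S] D.carrier)}
    (hy : y ∈ tensorGrading (A := G.S) 𝒜 (tensorGrading (A := G.S) C.gr D.gr) k) :
    TensorProduct.AlgebraTensorModule.distribBaseChange G.S R C.carrier D.carrier y ∈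
      tensorGrading (A := R) (tensorGrading (A := G.S) 𝒜 C.gr)
        (tensorGrading (A := G.S) 𝒜 D.gr) k := by
  let Φ := TensorProduct.AlgebraTensorModule.distribBaseChange G.S R C.carrier D.carrier
  refine map_mem_of_tensorGrading (M' := (R ⊗[G.S] C.carrier) ⊗[R] (R ⊗[G.S] D.carrier))
    (Φ : _ ≃ₗ[R] _).toLinearMap.toAddMonoidHom ?_ hy
  rintro p q r z hr hz rfl
  refine map_mem_of_tensorGrading (M' := (R ⊗[G.S] C.carrier) ⊗[R] (R ⊗[G.S] D.carrier))
    ((Φ : _ ≃ₗ[R] _).toLinearMap.toAddMonoidHom.comp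
      ((TensorProduct.mk G.S _ _ r).toAddMonoidHom)) ?_ hz
  rintro q₁ q₂ c d hc hd rfl
  change Φ (r ⊗ₜ (c ⊗ₜ d)) ∈ _
  -- The image is `(r ⊗ c) ⊗ (1 ⊗ d)`; the coefficient 1 accounts for the degree zero in `0 + q₂`.
  rw [TensorProduct.AlgebraTensorModule.distribBaseChange_tmul, ← add_assoc, ← zero_add q₂]
  exact tmul_mem_tensorGrading (tmul_mem_tensorGrading hr hc)
    (tmul_mem_tensorGrading SetLike.GradedOne.one_mem hd)

/-- Transport of a tower splitting along an equality of sign involutions. -/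
def _root_.TowerSplitting.ofEq {R M : Type u} [CommRing R] [AddCommGroup M] [Module R M]
    {𝒜 : ℤ × ℤ → AddSubgroup R} {P : ℤ × ℤ → AddSubgroup M} {σ σ' d : M →ₗ[R] M} {n : ℤ × ℤ}
    (T : TowerSplitting 𝒜 P σ d n) (h : σ = σ') : TowerSplitting 𝒜 P σ' d n :=
  T.congr (LinearEquiv.refl R M) (fun y => by rw [h]; rfl) (fun _ => rfl) (fun _ _ hy => hy)
    (fun _ _ hy => hy)

/-- The tensor product of tower splittings over the base change. -/
noncomputable def towerOverTensor [IsDomain R] (T : C.TowerOver 𝒜 n) (T' : D.TowerOver 𝒜 m) :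
    TowerSplitting 𝒜 (tensorGrading (A := G.S) 𝒜 (tensorGrading (A := G.S) C.gr D.gr))
      ((TensorProduct.map C.sign D.sign).baseChange R) ((tensorD C D).baseChange R) (n + m) :=
  let Φ := TensorProduct.AlgebraTensorModule.distribBaseChange G.S R C.carrier D.carrier
  (TowerSplitting.tensor T T').congr
    Φ.symm
    (fun y => by
      refine DFunLike.congr_fun (f := LinearMap.comp Φ.symm.toLinearMap
        (TensorProduct.map (C.sign.baseChange R) (D.sign.baseChange R)))
        (g := LinearMap.comp ((TensorProduct.map C.sign D.sign).baseChange R)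
          Φ.symm.toLinearMap) ?_ y
      ext c d
      change Φ.symm (TensorProduct.map (C.sign.baseChange R) (D.sign.baseChange R)
        ((1 ⊗ₜ c) ⊗ₜ (1 ⊗ₜ d))) =
        (TensorProduct.map C.sign D.sign).baseChange R (Φ.symm ((1 ⊗ₜ c) ⊗ₜ (1 ⊗ₜ d)))
      simp only [Φ, TensorProduct.map_tmul, LinearMap.baseChange_tmul,
        TensorProduct.AlgebraTensorModule.distribBaseChange_symm_tmul])
    (fun y => by
      refine DFunLike.congr_fun (f := LinearMap.comp Φ.symm.toLinearMap
        (TensorProduct.map (C.d.baseChange R) LinearMap.id +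
          TensorProduct.map (C.sign.baseChange R) (D.d.baseChange R)))
        (g := LinearMap.comp ((tensorD C D).baseChange R)
          Φ.symm.toLinearMap) ?_ y
      ext c d
      change Φ.symm (TensorProduct.map (C.d.baseChange R) LinearMap.id ((1 ⊗ₜ c) ⊗ₜ (1 ⊗ₜ d)) +
        TensorProduct.map (C.sign.baseChange R) (D.d.baseChange R) ((1 ⊗ₜ c) ⊗ₜ (1 ⊗ₜ d))) =
        (tensorD C D).baseChange R (Φ.symm ((1 ⊗ₜ c) ⊗ₜ (1 ⊗ₜ d)))
      simp only [Φ, tensorD, LinearMap.add_apply, TensorProduct.map_tmul,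
        LinearMap.baseChange_tmul, LinearMap.id_apply, map_add, TensorProduct.tmul_add,
        TensorProduct.AlgebraTensorModule.distribBaseChange_symm_tmul])
    (fun _ _ hy => distribBaseChange_symm_mem hy)
    (fun _ _ hy => distribBaseChange_mem hy)

/-- The tensor product of tower splittings. -/
noncomputable def TowerOver.tensor [IsDomain R] (T : C.TowerOver 𝒜 n) (T' : D.TowerOver 𝒜 m) :
    (tensor C D).TowerOver 𝒜 (n + m) :=
  (towerOverTensor T T').ofEq
    (congrArg (LinearMap.baseChange R) (SComplex.sign_tensor C D).symm)

variable (G) in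
/-- The tower of the grid ring with zero differential. -/
noncomputable def towerSplittingGrid [IsDomain R] (hS : GridDatum.IsGradedAlgebra (G := G) 𝒜) :
    TowerSplitting 𝒜 (tensorGrading (A := G.S) 𝒜 G.gr)
      (LinearMap.id : R ⊗[G.S] G.S →ₗ[R] R ⊗[G.S] G.S) 0 0 where
  x := (1 : R) ⊗ₜ[G.S] (1 : G.S)
  p := (TensorProduct.AlgebraTensorModule.rid G.S R R).toLinearMap
  h := 0
  a := 1
  x_mem := by
    rw [← add_zero (0 : ℤ × ℤ)]
    exact tmul_mem_tensorGrading SetLike.GradedOne.one_mem SetLike.GradedOne.one_mem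
  p_mem := by
    intro m y hy
    rw [sub_zero]
    refine map_mem_of_tensorGrading
      (TensorProduct.AlgebraTensorModule.rid G.S R R).toLinearMap.toAddMonoidHom ?_ hy
    rintro p q r s hr hs rfl
    change s • r ∈ _
    rw [Algebra.smul_def, add_comm]
    exact SetLike.GradedMul.mul_mem (hS _ _ hs) hr
  d_x := rfl
  p_d := fun _ => LinearMap.map_zero _
  p_x := by
    change (1 : G.S) • (1 : R) = 1
    exact one_smul _ _
  sign_x := rfl
  p_sign := fun y => rfl
  a_ne_zero := one_ne_zero
  sign_h := fun y => neg_zero.symm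
  homotopy := fun y => by
    induction y using TensorProduct.induction_on with
    | zero =>
      rw [LinearMap.map_zero, zero_smul, sub_zero, smul_zero]
      exact (add_zero _).symm
    | tmul r s =>
      have : (TensorProduct.AlgebraTensorModule.rid G.S R R).toLinearMap (r ⊗ₜ s) = s • r := rfl
      rw [this, TensorProduct.smul_tmul', smul_eq_mul, mul_one, TensorProduct.smul_tmul,
        smul_eq_mul, mul_one, sub_self, smul_zero]
      exact (add_zero _).symm
    | add y z hy hz =>
      simp only [LinearMap.zero_apply, add_zero, one_smul, sub_eq_zero] at hy hz ⊢
      rw [LinearMap.map_add, add_smul, ← hy, ← hz]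

theorem sign_trivial : (trivial G).sign = LinearMap.id :=
  sign_unique (trivial G) LinearMap.id fun _ _ hx =>
    (GridDatum.negOnePow_smul_of_mem (G := G) hx).symm

/-- The tower of the trivial complex. -/
noncomputable def towerOverTrivial [IsDomain R] (hS : GridDatum.IsGradedAlgebra (G := G) 𝒜) :
    (trivial G).TowerOver 𝒜 0 :=
  TowerSplitting.congr (towerSplittingGrid G hS) (LinearEquiv.refl R (R ⊗[G.S] G.S))
    (fun y => by
      rw [sign_trivial]
      exact (LinearMap.congr_fun LinearMap.baseChange_id y).symm)
    (fun y => (LinearMap.congr_fun LinearMap.baseChange_zero y).symm)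
    (fun _ _ hy => hy) (fun _ _ hy => hy)

end

theorem isKnotlike_trivial : (trivial G).IsKnotlike where
  reduced _ := zero_mem _
  left := by
    have _ := G.typeZeroU.isDomain
    exact isLeftKnotlike_iff.2 ⟨0, ⟨towerOverTrivial GridDatum.isGradedAlgebra_grU⟩⟩
  right := by
    have _ := G.typeZeroV.isDomain
    exact isRightKnotlike_iff.2 ⟨0, ⟨towerOverTrivial GridDatum.isGradedAlgebra_grV⟩⟩

theorem map_mem_smul_top {A M N : Type u} [CommRing A] [AddCommGroup M] [AddCommGroup N]
    [Module A M] [Module A N] (I : Ideal A) (F : M →ₗ[A] N) {x : M}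
    (hx : x ∈ I • (⊤ : Submodule A M)) : F x ∈ I • (⊤ : Submodule A N) :=
  (Submodule.smul_top_le_comap_smul_top I F) hx

theorem isReduced_tensor {C D : SComplex G} (hC : C.IsReduced) (hD : D.IsReduced) :
    (tensor C D).IsReduced := by
  intro (t : C.carrier ⊗[G.S] D.carrier)
  change tensorD C D t ∈ RingHom.ker G.toK • (⊤ : Submodule G.S (C.carrier ⊗[G.S] D.carrier))
  induction t using TensorProduct.induction_on with
  | zero => rw [map_zero]; exact zero_mem _
  | tmul c d =>
    exact add_mem (map_mem_smul_top _ ((TensorProduct.mk G.S _ _).flip d) (hC c))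
      (map_mem_smul_top _ (TensorProduct.mk G.S _ _ (C.sign c)) (hD d))
  | add x y hx hy => rw [map_add]; exact add_mem hx hy

/-- Tower splittings multiply and the degrees of their generators add, so the vanishing coordinate
of each shift is preserved. -/
theorem isKnotlike_tensor {C D : SComplex G} (hC : C.IsKnotlike) (hD : D.IsKnotlike) :
    (tensor C D).IsKnotlike where
  reduced := isReduced_tensor hC.reduced hD.reduced
  left := by
    have _ := G.typeZeroU.isDomain
    obtain ⟨i, ⟨T⟩⟩ := isLeftKnotlike_iff.1 hC.left
    obtain ⟨j, ⟨T'⟩⟩ := isLeftKnotlike_iff.1 hD.left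
    exact isLeftKnotlike_iff.2 ⟨i + j, ⟨T.tensor T'⟩⟩
  right := by
    have _ := G.typeZeroV.isDomain
    obtain ⟨i, ⟨T⟩⟩ := isRightKnotlike_iff.1 hC.right
    obtain ⟨j, ⟨T'⟩⟩ := isRightKnotlike_iff.1 hD.right
    exact isRightKnotlike_iff.2 ⟨i + j, ⟨T.tensor T'⟩⟩

end SComplex

namespace SComplex

variable {G : GridDatum.{u}}

/-! ### Local maps -/

variable {C D E C' D' : SComplex G}

theorem isLocalMap_iff_isUnit {n m : ℤ × ℤ} (T : C.TowerOver G.grV n) (T' : D.TowerOver G.grV m)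
    {f : C.carrier →ₗ[G.S] D.carrier} (chain : f ∘ₗ C.d = D.d ∘ₗ f) :
    Function.Bijective (homologyModTorsionMap (f.baseChange G.RV) (baseChange_chain chain)) ↔
      IsUnit (T'.p (f.baseChange G.RV T.x)) := by
  have _ := G.typeZeroV.isDomain
  exact T.bijective_iff T' _ _

/-- The sign sees only `gr₁`, which `f` preserves. This is what makes `f ⊗ g` commute with the
product differential. -/
theorem map_sign {f : C.carrier →ₗ[G.S] D.carrier} {j : ℤ}
    (hf : ∀ (n : ℤ × ℤ) (x : C.carrier), x ∈ C.gr n → f x ∈ D.gr (n + (0, j))) (x : C.carrier) :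
    f (C.sign x) = D.sign (f x) := by
  refine induction_homogeneous C.isInternal (p := fun x => f (C.sign x) = D.sign (f x))
    (by simp) ?_ (fun x y hx hy => by simp only [map_add, hx, hy]) x
  intro n x hx
  rw [C.sign_of_mem hx, D.sign_of_mem (hf n x hx), map_zsmul, Prod.fst_add, add_zero]

/-- With the product splittings, the number deciding whether `f ⊗ g` is local is the product of
those for `f` and `g`, hence a unit. -/
theorem LocalLE.tensor (hC : C.IsKnotlike) (hD : D.IsKnotlike) (hC' : C'.IsKnotlike)
    (hD' : D'.IsKnotlike) (h : LocalLE C C') (h' : LocalLE D D') :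
    LocalLE (tensor C D) (tensor C' D') := by
  have _ := G.typeZeroV.isDomain
  obtain ⟨f, hf⟩ := h
  obtain ⟨g, hg⟩ := h'
  obtain ⟨i, hi⟩ := hf.homogeneous
  obtain ⟨j, hj⟩ := hg.homogeneous
  obtain ⟨_, ⟨TC⟩⟩ := isRightKnotlike_iff.1 hC.right
  obtain ⟨_, ⟨TD⟩⟩ := isRightKnotlike_iff.1 hD.right
  obtain ⟨_, ⟨TC'⟩⟩ := isRightKnotlike_iff.1 hC'.right
  obtain ⟨_, ⟨TD'⟩⟩ := isRightKnotlike_iff.1 hD'.right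
  have hchain : TensorProduct.map f g ∘ₗ tensorD C D = tensorD C' D' ∘ₗ TensorProduct.map f g := by
    refine TensorProduct.ext' fun x y => ?_
    have h1 : f (C.d x) = C'.d (f x) := LinearMap.congr_fun hf.chain x
    have h2 : g (D.d y) = D'.d (g y) := LinearMap.congr_fun hg.chain y
    simp only [tensorD, LinearMap.comp_apply, LinearMap.add_apply, TensorProduct.map_tmul,
      LinearMap.id_apply, map_add, h1, h2, map_sign hi]
  refine ⟨TensorProduct.map f g, hchain, ⟨i + j, fun n t ht => ?_⟩, ?_⟩
  · refine map_mem_of_tensorGrading (TensorProduct.map f g).toAddMonoidHom ?_ ht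
    rintro p q x y hx hy rfl
    have h := tmul_mem_tensorGrading (A := G.S) (hi p x hx) (hj q y hy)
    rwa [add_add_add_comm, show ((0, i) + (0, j) : ℤ × ℤ) = (0, i + j) from rfl] at h
  · refine (isLocalMap_iff_isUnit (TC.tensor TD) (TC'.tensor TD') hchain).2 ?_
    have hu := ((isLocalMap_iff_isUnit TC TC' hf.chain).1 hf.bijective).mul
      ((isLocalMap_iff_isUnit TD TD' hg.chain).1 hg.bijective)
    let Φ := TensorProduct.AlgebraTensorModule.distribBaseChange G.S G.RV C.carrier D.carrier
    let Ψ := TensorProduct.AlgebraTensorModule.distribBaseChange G.S G.RV C'.carrier D'.carrier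
    have key : ((TensorProduct.map f g).baseChange G.RV) ∘ₗ Φ.symm.toLinearMap =
        Ψ.symm.toLinearMap ∘ₗ
          TensorProduct.map (f.baseChange G.RV) (g.baseChange G.RV) := by
      ext c d
      change (TensorProduct.map f g).baseChange G.RV (Φ.symm ((1 ⊗ₜ c) ⊗ₜ (1 ⊗ₜ d))) =
        Ψ.symm (TensorProduct.map (f.baseChange G.RV) (g.baseChange G.RV)
          ((1 ⊗ₜ c) ⊗ₜ (1 ⊗ₜ d)))
      simp only [Φ, Ψ, TensorProduct.map_tmul, LinearMap.baseChange_tmul,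
        TensorProduct.AlgebraTensorModule.distribBaseChange_symm_tmul]
    have key' := LinearMap.congr_fun key (TC.x ⊗ₜ TD.x)
    change IsUnit ((LinearMap.mul' G.RV G.RV ∘ₗ TensorProduct.map TC'.p TD'.p)
      (Ψ ((TensorProduct.map f g).baseChange G.RV (Φ.symm (TC.x ⊗ₜ TD.x)))))
    have key2 : (TensorProduct.map f g).baseChange G.RV (Φ.symm (TC.x ⊗ₜ TD.x)) =
      Ψ.symm (f.baseChange G.RV TC.x ⊗ₜ g.baseChange G.RV TD.x) := key'
    rw [key2, LinearEquiv.apply_symm_apply]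
    exact hu

/-- A homogeneous isomorphism of complexes is a local map. -/
theorem isLocalMap_of_equiv (e : C.carrier ≃ₗ[G.S] D.carrier)
    (chain : e.toLinearMap ∘ₗ C.d = D.d ∘ₗ e.toLinearMap)
    (he : ∀ (n : ℤ × ℤ) (x : C.carrier), x ∈ C.gr n → e x ∈ D.gr n) :
    IsLocalMap e.toLinearMap where
  chain := chain
  homogeneous := ⟨0, fun n x hx => by simpa [← Prod.zero_eq_mk] using he n x hx⟩
  bijective := by
    have chain' : e.symm.toLinearMap ∘ₗ D.d = C.d ∘ₗ e.symm.toLinearMap := by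
      refine LinearMap.ext fun y => ?_
      obtain ⟨x, rfl⟩ := e.surjective y
      have := LinearMap.congr_fun chain x
      simp only [LinearMap.comp_apply, LinearEquiv.coe_coe] at this
      simp [← this]
    have h1 : ∀ y, e.symm.toLinearMap.baseChange G.RV (e.toLinearMap.baseChange G.RV y) = y :=
      fun y => by
        rw [← LinearMap.comp_apply, ← LinearMap.baseChange_comp, LinearEquiv.symm_comp,
          LinearMap.baseChange_id]
        rfl
    have h2 : ∀ y, e.toLinearMap.baseChange G.RV (e.symm.toLinearMap.baseChange G.RV y) = y :=
      fun y => by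
        rw [← LinearMap.comp_apply, ← LinearMap.baseChange_comp, LinearEquiv.comp_symm,
          LinearMap.baseChange_id]
        rfl
    refine Function.bijective_iff_has_inverse.2
      ⟨homologyModTorsionMap (e.symm.toLinearMap.baseChange G.RV) (baseChange_chain chain'),
        fun y => ?_, fun y => ?_⟩
    · obtain ⟨z, rfl⟩ := cycleClass_surjective _ y
      rw [homologyModTorsionMap_cycleClass, homologyModTorsionMap_cycleClass]
      exact congrArg _ (Subtype.ext (h1 z))
    · obtain ⟨z, rfl⟩ := cycleClass_surjective _ y
      rw [homologyModTorsionMap_cycleClass, homologyModTorsionMap_cycleClass]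
      exact congrArg _ (Subtype.ext (h2 z))

theorem localLE_antisymmRel_of_equiv (e : C.carrier ≃ₗ[G.S] D.carrier)
    (chain : e.toLinearMap ∘ₗ C.d = D.d ∘ₗ e.toLinearMap)
    (he : ∀ (n : ℤ × ℤ) (x : C.carrier), x ∈ C.gr n → e x ∈ D.gr n)
    (he' : ∀ (n : ℤ × ℤ) (x : D.carrier), x ∈ D.gr n → e.symm x ∈ C.gr n) :
    LocalLE C D ∧ LocalLE D C := by
  refine ⟨⟨_, isLocalMap_of_equiv e chain he⟩, ⟨_, isLocalMap_of_equiv e.symm ?_ he'⟩⟩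
  refine LinearMap.ext fun y => ?_
  obtain ⟨x, rfl⟩ := e.surjective y
  have := LinearMap.congr_fun chain x
  simp only [LinearMap.comp_apply, LinearEquiv.coe_coe] at this
  simp [← this]

/-! ### Unit, associativity and commutativity -/

/-- The unit isomorphism commutes with the differentials because the trivial complex has trivial
sign; no Koszul sign appears. -/
theorem lid_comp_map_id {A M : Type u} [CommRing A] [AddCommGroup M] [Module A M]
    (d : M →ₗ[A] M) (σ : A →ₗ[A] A) (hσ : σ = LinearMap.id) :
    (TensorProduct.lid A M).toLinearMap ∘ₗ
      (TensorProduct.map (0 : A →ₗ[A] A) LinearMap.id + TensorProduct.map σ d) =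
      d ∘ₗ (TensorProduct.lid A M).toLinearMap := by
  refine TensorProduct.ext' fun s c => ?_
  simp [hσ]

theorem localLE_trivial_tensor (C : SComplex G) :
    LocalLE (tensor (trivial G) C) C ∧ LocalLE C (tensor (trivial G) C) := by
  refine localLE_antisymmRel_of_equiv (C := tensor (trivial G) C)
    (TensorProduct.lid G.S C.carrier) (lid_comp_map_id C.d _ sign_trivial)
    (fun n t ht => ?_) (fun n c hc => ?_)
  · refine map_mem_of_tensorGrading (P := G.gr) (Q := C.gr)
      (TensorProduct.lid G.S C.carrier).toLinearMap.toAddMonoidHom ?_ ht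
    rintro p q s c hs hc rfl
    change s • c ∈ _
    exact C.smul_mem hs hc
  · have := tmul_mem_tensorGrading (A := G.S) (P := G.gr) (p := 0) (x := 1)
      SetLike.GradedOne.one_mem hc
    rwa [zero_add] at this

/-- Both differentials expand to `d ⊗ 1 ⊗ 1 + σ ⊗ d' ⊗ 1 + σ ⊗ σ' ⊗ d''`, using that the sign of a
product is the product of the signs. -/
theorem assoc_comp_differential {A M N L : Type u} [CommRing A] [AddCommGroup M] [Module A M]
    [AddCommGroup N] [Module A N] [AddCommGroup L] [Module A L] (d σ : M →ₗ[A] M)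
    (d' σ' : N →ₗ[A] N) (d'' : L →ₗ[A] L) (τ : M ⊗[A] N →ₗ[A] M ⊗[A] N)
    (hτ : τ = TensorProduct.map σ σ') :
    (TensorProduct.assoc A M N L).toLinearMap ∘ₗ
      (TensorProduct.map (TensorProduct.map d LinearMap.id + TensorProduct.map σ d')
        LinearMap.id + TensorProduct.map τ d'') =
      (TensorProduct.map d LinearMap.id + TensorProduct.map σ
        (TensorProduct.map d' LinearMap.id + TensorProduct.map σ' d'')) ∘ₗ
        (TensorProduct.assoc A M N L).toLinearMap := by
  refine TensorProduct.ext_threefold fun x y z => ?_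
  simp [hτ, TensorProduct.add_tmul, TensorProduct.tmul_add, add_assoc]

theorem localLE_tensor_assoc (C D E : SComplex G) :
    LocalLE (tensor (tensor C D) E) (tensor C (tensor D E)) ∧
      LocalLE (tensor C (tensor D E)) (tensor (tensor C D) E) := by
  refine localLE_antisymmRel_of_equiv (C := tensor (tensor C D) E) (D := tensor C (tensor D E))
    (TensorProduct.assoc G.S C.carrier D.carrier E.carrier)
    (assoc_comp_differential _ _ _ _ _ _ (sign_tensor C D)) (fun n t ht => ?_) (fun n t ht => ?_)
  · refine map_mem_of_tensorGrading
      (M' := C.carrier ⊗[G.S] (D.carrier ⊗[G.S] E.carrier))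
      (P := tensorGrading (A := G.S) C.gr D.gr) (Q := E.gr)
      (TensorProduct.assoc G.S C.carrier D.carrier E.carrier).toLinearMap.toAddMonoidHom ?_ ht
    rintro p q x z hx hz rfl
    refine map_mem_of_tensorGrading
      (M' := C.carrier ⊗[G.S] (D.carrier ⊗[G.S] E.carrier))
      ((TensorProduct.assoc G.S C.carrier D.carrier E.carrier).toLinearMap ∘ₗ
        (TensorProduct.mk G.S _ _).flip z).toAddMonoidHom ?_ hx
    rintro p₁ p₂ c d hc hd rfl
    change c ⊗ₜ (d ⊗ₜ z) ∈ tensorGrading (A := G.S) C.gr (tensorGrading (A := G.S) D.gr E.gr) _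
    rw [add_assoc]
    exact tmul_mem_tensorGrading hc (tmul_mem_tensorGrading hd hz)
  · refine map_mem_of_tensorGrading
      (M' := (C.carrier ⊗[G.S] D.carrier) ⊗[G.S] E.carrier)
      (P := C.gr) (Q := tensorGrading (A := G.S) D.gr E.gr)
      (TensorProduct.assoc G.S C.carrier D.carrier E.carrier).symm.toLinearMap.toAddMonoidHom
      ?_ ht
    rintro p q c x hc hx rfl
    refine map_mem_of_tensorGrading
      (M' := (C.carrier ⊗[G.S] D.carrier) ⊗[G.S] E.carrier)
      ((TensorProduct.assoc G.S C.carrier D.carrier E.carrier).symm.toLinearMap ∘ₗ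
        TensorProduct.mk G.S _ _ c).toAddMonoidHom ?_ hx
    rintro q₁ q₂ d z hd hz rfl
    change (c ⊗ₜ d) ⊗ₜ z ∈ tensorGrading (A := G.S) (tensorGrading (A := G.S) C.gr D.gr) E.gr _
    rw [← add_assoc]
    exact tmul_mem_tensorGrading (tmul_mem_tensorGrading hc hd) hz

/-- Linear maps out of a product of complexes agree if they agree on products of homogeneous
elements. -/
theorem tensor_ext_homogeneous {N : Type u} [AddCommGroup N] [Module G.S N]
    {F F' : C.carrier ⊗[G.S] D.carrier →ₗ[G.S] N}
    (h : ∀ p q x y, x ∈ C.gr p → y ∈ D.gr q → F (x ⊗ₜ y) = F' (x ⊗ₜ y)) : F = F' := by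
  refine TensorProduct.ext' fun x y => ?_
  refine induction_homogeneous C.isInternal (p := fun x => F (x ⊗ₜ y) = F' (x ⊗ₜ y))
    (by simp) ?_ (fun x x' hx hx' => by simp only [TensorProduct.add_tmul, map_add, hx, hx']) x
  intro p x hx
  refine induction_homogeneous D.isInternal (p := fun y => F (x ⊗ₜ y) = F' (x ⊗ₜ y))
    (by simp) ?_ (fun y y' hy hy' => by simp only [TensorProduct.tmul_add, map_add, hy, hy']) y
  exact fun q y hy => h p q x y hx hy

/-- Makes the Koszul sign of the braiding insensitive to moving scalars, hence compatible with
`S`-linearity. -/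
theorem negOnePow_mul_smul_of_mem {n : ℤ × ℤ} {s : G.S} (hs : s ∈ G.gr n) (k : ℤ) :
    ((k * n.1).negOnePow : ℤ) • s = s := by
  rcases Int.even_or_odd k with h | h
  · rw [Int.negOnePow_even _ (h.mul_right _)]; simp
  · obtain ⟨l, rfl⟩ := h
    have : (2 * l + 1) * n.1 = 2 * (l * n.1) + n.1 := by ring
    rw [this, Int.negOnePow_add, Int.negOnePow_even _ (even_two_mul _), one_mul]
    exact GridDatum.negOnePow_smul_of_mem hs

/-- The braiding of the product of two complexes. -/
theorem exists_braiding (C D : SComplex G) :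
    ∃ τ : C.carrier ⊗[G.S] D.carrier →ₗ[G.S] D.carrier ⊗[G.S] C.carrier,
      ∀ p q x y, x ∈ C.gr p → y ∈ D.gr q →
        τ (x ⊗ₜ y) = ((p.1 * q.1).negOnePow : ℤ) • (y ⊗ₜ x) := by
  classical
  obtain ⟨r, c, ε, hc⟩ := D.exists_isGradedBasis
  -- `s k` is the `k`-th power of the sign involution, the factor for swapping past an element with
  -- `gr₁ = k`. Using it on each vector of a homogeneous basis of `D` gives a manifestly linear map.
  let s : ℤ → (C.carrier →ₗ[G.S] C.carrier) := fun k => if Even k then LinearMap.id else C.sign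
  have hs : ∀ k p x, x ∈ C.gr p → s k x = ((p.1 * k).negOnePow : ℤ) • x := by
    intro k p x hx
    by_cases h : Even k
    · simp [s, h, Int.negOnePow_even _ (h.mul_left p.1)]
    · obtain ⟨l, rfl⟩ := Int.not_even_iff_odd.1 h
      have e : p.1 * (2 * l + 1) = 2 * (p.1 * l) + p.1 := by ring
      simp only [s, h, if_false]
      rw [C.sign_of_mem hx, e, Int.negOnePow_add, Int.negOnePow_even _ (even_two_mul _), one_mul]
  refine ⟨(TensorProduct.comm G.S C.carrier D.carrier).toLinearMap ∘ₗ
    ∑ j, TensorProduct.map (s (ε j).1) ((c.coord j).smulRight (c j)), fun p q x y hx hy => ?_⟩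
  -- The degrees `q` of `y` and `ε j` of `c j` differ by the degree of the coefficient, on which the
  -- sign acts trivially; so the formula does not depend on the basis.
  have key : ∀ j, ((p.1 * (ε j).1).negOnePow : ℤ) • c.repr y j =
      ((p.1 * q.1).negOnePow : ℤ) • c.repr y j := by
    intro j
    have h := negOnePow_mul_smul_of_mem ((hc q y).1 hy j) p.1
    conv_rhs => rw [← h]
    rw [smul_smul, ← Units.val_mul, ← Int.negOnePow_add, Prod.fst_sub]
    have e : p.1 * q.1 + p.1 * (q.1 - (ε j).1) = 2 * (p.1 * (q.1 - (ε j).1)) + p.1 * (ε j).1 := by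
      ring
    rw [e, Int.negOnePow_add, Int.negOnePow_even _ (even_two_mul _), one_mul]
  rw [LinearMap.comp_apply, LinearMap.sum_apply, map_sum]
  conv_rhs => rw [← c.sum_repr y, TensorProduct.sum_tmul, Finset.smul_sum]
  refine Finset.sum_congr rfl fun j _ => ?_
  rw [TensorProduct.map_tmul, hs _ _ _ hx, LinearEquiv.coe_coe, TensorProduct.comm_tmul,
    LinearMap.smulRight_apply, Module.Basis.coord_apply, TensorProduct.tmul_smul,
    TensorProduct.smul_tmul', TensorProduct.smul_tmul', ← smul_assoc, key, smul_assoc]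

theorem localLE_tensor_comm (C D : SComplex G) : LocalLE (tensor C D) (tensor D C) := by
  obtain ⟨τ, hτ⟩ := exists_braiding C D
  obtain ⟨τ', hτ'⟩ := exists_braiding D C
  have h1 : τ' ∘ₗ τ = LinearMap.id := tensor_ext_homogeneous fun p q x y hx hy => by
    rw [LinearMap.comp_apply, hτ p q x y hx hy, map_zsmul, hτ' q p y x hy hx, smul_smul,
      mul_comm q.1, ← Units.val_mul, Int.units_mul_self, Units.val_one, one_smul,
      LinearMap.id_apply]
  have h2 : τ ∘ₗ τ' = LinearMap.id := tensor_ext_homogeneous fun p q x y hx hy => by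
    rw [LinearMap.comp_apply, hτ' p q x y hx hy, map_zsmul, hτ q p y x hy hx, smul_smul,
      mul_comm q.1, ← Units.val_mul, Int.units_mul_self, Units.val_one, one_smul,
      LinearMap.id_apply]
  have hchain : τ ∘ₗ tensorD C D = tensorD D C ∘ₗ τ := tensor_ext_homogeneous
    fun p q x y hx hy => by
      rw [LinearMap.comp_apply, LinearMap.comp_apply, hτ p q x y hx hy, tensorD_tmul C D hx,
        map_zsmul, tensorD_tmul D C hy, map_add, map_zsmul, hτ _ q _ y (C.d_mem hx) hy,
        hτ p _ x _ hx (D.d_mem hy), smul_add, smul_smul, smul_smul, ← Units.val_mul,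
        ← Units.val_mul, ← Int.negOnePow_add, ← Int.negOnePow_add, add_comm, Prod.fst_sub,
        Prod.fst_sub]
      -- Matching of the Koszul signs in the two terms of the differential; the second equality
      -- holds modulo 2.
      have e1 : p.1 + p.1 * (q.1 - 1) = p.1 * q.1 := by ring
      have e2 : ((p.1 - 1) * q.1).negOnePow = (p.1 * q.1 + q.1).negOnePow := by
        have : p.1 * q.1 + q.1 = 2 * q.1 + (p.1 - 1) * q.1 := by ring
        rw [this, Int.negOnePow_add, Int.negOnePow_even _ (even_two_mul _), one_mul]
      rw [e1, e2]
  refine ⟨_, isLocalMap_of_equiv (C := tensor C D) (D := tensor D C)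
    (LinearEquiv.ofLinearMap τ τ' h2 h1) hchain fun n t ht => ?_⟩
  refine map_mem_of_tensorGrading (M' := D.carrier ⊗[G.S] C.carrier) (P := C.gr) (Q := D.gr)
    τ.toAddMonoidHom ?_ ht
  rintro p q x y hx hy rfl
  change τ (x ⊗ₜ y) ∈ tensorGrading (A := G.S) D.gr C.gr _
  rw [hτ p q x y hx hy, add_comm]
  exact zsmul_mem (tmul_mem_tensorGrading hy hx) _

end SComplex

namespace SComplex

variable {G : GridDatum.{u}}

/-! ### Dual complexes -/

instance (C : SComplex G) : Module.Free G.S C.carrier :=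
  let ⟨_, b, _⟩ := C.exists_basis
  Module.Free.of_basis b

instance (C : SComplex G) : Module.Finite G.S C.carrier :=
  let ⟨_, b, _⟩ := C.exists_basis
  Module.Finite.of_basis b

theorem isGradedBasis_dualBasis {C : SComplex G} {r : ℕ}
    {b : Module.Basis (Fin r) G.S C.carrier} {δ : Fin r → ℤ × ℤ}
    (hb : IsGradedBasis G.gr C.gr b δ) :
    IsGradedBasis G.gr (dualGrading G.gr C.gr) b.dualBasis (-δ) := by
  intro n φ
  simp only [Module.Basis.dualBasis_repr, Pi.neg_apply, sub_neg_eq_add]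
  constructor
  · intro hφ i
    rw [add_comm]
    exact hφ _ _ (hb.basis_mem i)
  · intro h m y hy
    exact hb.apply_mem_of_basis (fun i => by rw [add_comm]; exact h i) hy

/-- The dual complex, with differential `φ ↦ φ ∘ ∂ ∘ (-1)^{gr₁}`. -/
noncomputable def dual (C : SComplex G) : SComplex G where
  carrier := Module.Dual G.S C.carrier
  gr := dualGrading G.gr C.gr
  isInternal := by
    obtain ⟨r, b, δ, hb⟩ := C.exists_isGradedBasis
    exact isInternal_of_repr _ b.dualBasis (-δ) (isGradedBasis_dualBasis hb)
  smul_mem := by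
    obtain ⟨r, b, δ, hb⟩ := C.exists_isGradedBasis
    exact fun hs hx => (isGradedBasis_dualBasis hb).smul_mem hs hx
  exists_basis := by
    obtain ⟨r, b, δ, hb⟩ := C.exists_isGradedBasis
    exact ⟨r, b.dualBasis, -δ, (isGradedBasis_dualBasis hb).basis_mem⟩
  parity := by
    intro n hn
    obtain ⟨r, b, δ, hb⟩ := C.exists_isGradedBasis
    obtain ⟨⟨φ, hφ⟩, hφ0⟩ := AddSubgroup.ne_bot_iff_exists_ne_zero.1 hn
    obtain ⟨i, hi⟩ : ∃ i, φ (b i) ≠ 0 := by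
      by_contra! h
      exact hφ0 (Subtype.ext (b.ext h))
    have h1 := GridDatum.gr_parity (δ i + n) fun h => hi (by
      rw [← AddSubgroup.mem_bot, ← h]
      exact hφ _ _ (hb.basis_mem i))
    have h2 := C.parity (δ i) fun h => hi (by
      have : b i = 0 := by simpa [h] using hb.basis_mem i
      rw [this, map_zero])
    have h3 := h1.sub h2
    rwa [Prod.fst_add, Prod.snd_add, add_sub_cancel_left, add_sub_cancel_left] at h3
  d := (C.d ∘ₗ C.sign).dualMap
  d_mem := by
    intro n φ hφ m y hy
    have := hφ _ _ (C.d_mem (C.sign_mem hy))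
    rwa [sub_add_comm, add_comm] at this
  d_comp_d := by
    refine LinearMap.ext fun φ => LinearMap.ext fun y => ?_
    have h : C.d (C.d (C.sign (C.sign y))) = 0 := LinearMap.congr_fun C.d_comp_d _
    simp [sign_d, h]

/-- For homogeneous `y` of degree `m`, the scalar `φ y` has degree `m + n` and trivial sign, so the
sign of `φ` equals the sign of `y`. -/
theorem sign_dual (C : SComplex G) : (dual C).sign = C.sign.dualMap := by
  refine sign_unique (dual C) C.sign.dualMap ?_
  intro n (φ : Module.Dual G.S C.carrier) hφ
  change C.sign.dualMap φ = (n.1.negOnePow : ℤ) • φ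
  refine LinearMap.ext fun y => ?_
  refine induction_homogeneous C.isInternal (p := fun y =>
    C.sign.dualMap φ y = ((n.1.negOnePow : ℤ) • φ) y) (by simp) ?_
    (fun y z hy hz => by rw [map_add, map_add, hy, hz]) y
  intro m y hy
  have h := GridDatum.negOnePow_smul_of_mem (hφ m y hy)
  rw [LinearMap.dualMap_apply, C.sign_of_mem hy, map_zsmul, LinearMap.smul_apply]
  conv_lhs => rw [← h]
  rw [smul_smul, ← Units.val_mul, ← Int.negOnePow_add, Prod.fst_add,
    show m.1 + (m.1 + n.1) = 2 * m.1 + n.1 by ring, Int.negOnePow_add,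
    Int.negOnePow_even _ (even_two_mul _), one_mul]

/-- In the dual basis the coefficients of the differential of `φ` are the values of `φ` on `∂ (σ (b
i))`, which lie in the ideal. -/
theorem isReduced_dual {C : SComplex G} (hC : C.IsReduced) : (dual C).IsReduced := by
  intro (φ : Module.Dual G.S C.carrier)
  obtain ⟨r, b, δ, hb⟩ := C.exists_isGradedBasis
  change (C.d ∘ₗ C.sign).dualMap φ ∈
    RingHom.ker G.toK • (⊤ : Submodule G.S (Module.Dual G.S C.carrier))
  rw [← b.dualBasis.sum_repr ((C.d ∘ₗ C.sign).dualMap φ)]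
  refine sum_mem fun i _ => Submodule.smul_mem_smul ?_ Submodule.mem_top
  have := map_mem_smul_top _ φ (hC (C.sign (b i)))
  rw [smul_eq_mul, Ideal.mul_top] at this
  simpa using this

section

variable {R : Type u} [CommRing R] [Algebra G.S R] {𝒜 : ℤ × ℤ → AddSubgroup R} [GradedRing 𝒜]
  {C : SComplex G} {n : ℤ × ℤ}

variable (R C) in
/-- Base change commutes with dualizing. -/
noncomputable def dualBaseChange :
    R ⊗[G.S] Module.Dual G.S C.carrier ≃ₗ[R] Module.Dual R (R ⊗[G.S] C.carrier) :=
  (TensorProduct.isBaseChange G.S C.carrier R).toDualBaseChange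

theorem dualBaseChange_tmul_tmul (r s : R) (φ : Module.Dual G.S C.carrier) (c : C.carrier) :
    dualBaseChange R C (r ⊗ₜ φ) (s ⊗ₜ c) = s * (r * algebraMap G.S R (φ c)) := by
  have h : s ⊗ₜ[G.S] c = s • TensorProduct.mk G.S R C.carrier 1 c := by
    rw [TensorProduct.mk_apply, TensorProduct.smul_tmul', smul_eq_mul, mul_one]
  rw [h, map_smul, smul_eq_mul]
  congr 1
  exact IsBaseChange.toDualBaseChange_tmul _ r φ c

theorem dualBaseChange_dualMap (F : C.carrier →ₗ[G.S] C.carrier)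
    (t : R ⊗[G.S] Module.Dual G.S C.carrier) :
    dualBaseChange R C (F.dualMap.baseChange R t) =
      (F.baseChange R).dualMap (dualBaseChange R C t) := by
  induction t using TensorProduct.induction_on with
  | zero => rw [LinearMap.map_zero, LinearEquiv.map_zero, LinearMap.map_zero]
  | tmul r φ =>
    refine LinearMap.ext fun y => ?_
    induction y using TensorProduct.induction_on with
    | zero => rw [LinearMap.map_zero, LinearMap.map_zero]
    | tmul s c =>
      rw [LinearMap.baseChange_tmul, dualBaseChange_tmul_tmul, LinearMap.dualMap_apply,
        LinearMap.dualMap_apply, LinearMap.baseChange_tmul, dualBaseChange_tmul_tmul]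
    | add y z hy hz => rw [LinearMap.map_add, LinearMap.map_add, hy, hz]
  | add x y hx hy =>
    rw [LinearMap.map_add, LinearEquiv.map_add, LinearEquiv.map_add, hx, hy, LinearMap.map_add]

theorem dualBaseChange_mem (hS : GridDatum.IsGradedAlgebra (G := G) 𝒜) {k : ℤ × ℤ}
    {t : R ⊗[G.S] Module.Dual G.S C.carrier}
    (ht : t ∈ tensorGrading (A := G.S) 𝒜 (dualGrading G.gr C.gr) k) :
    dualBaseChange R C t ∈ dualGrading 𝒜 (tensorGrading (A := G.S) 𝒜 C.gr) k := by
  refine map_mem_of_tensorGrading (dualBaseChange R C).toLinearMap.toAddMonoidHom ?_ ht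
  rintro p q r φ hr hφ rfl m y hy
  refine map_mem_of_tensorGrading (dualBaseChange R C (r ⊗ₜ φ)).toAddMonoidHom ?_ hy
  rintro i j s c hs hc rfl
  change dualBaseChange R C (r ⊗ₜ φ) (s ⊗ₜ c) ∈ _
  rw [dualBaseChange_tmul_tmul, show i + j + (p + q) = i + (p + (j + q)) by abel]
  exact SetLike.GradedMul.mul_mem hs (SetLike.GradedMul.mul_mem hr (hS _ _ (hφ _ _ hc)))

theorem dualBaseChange_symm_mem {k : ℤ × ℤ} {ψ : Module.Dual R (R ⊗[G.S] C.carrier)}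
    (hψ : ψ ∈ dualGrading 𝒜 (tensorGrading (A := G.S) 𝒜 C.gr) k) :
    (dualBaseChange R C).symm ψ ∈ tensorGrading (A := G.S) 𝒜 (dualGrading G.gr C.gr) k := by
  obtain ⟨r, b, δ, hb⟩ := C.exists_isGradedBasis
  -- Expansion in the dual basis gives an explicit inverse, from which degrees can be read off.
  have h : (dualBaseChange R C).symm ψ = ∑ i, ψ (1 ⊗ₜ b i) ⊗ₜ[G.S] b.dualBasis i := by
    rw [LinearEquiv.symm_apply_eq]
    refine (b.baseChange R).ext fun j => ?_
    rw [Module.Basis.baseChange_apply, map_sum, LinearMap.sum_apply]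
    simp_rw [dualBaseChange_tmul_tmul]
    simp [Finsupp.single_apply, apply_ite, Finset.sum_ite_eq]
  rw [h]
  refine sum_mem fun i _ => ?_
  have h1 := hψ _ _ (tmul_mem_tensorGrading (A := G.S) (P := 𝒜) SetLike.GradedOne.one_mem
    (hb.basis_mem i))
  have h2 := tmul_mem_tensorGrading (A := G.S) h1 ((isGradedBasis_dualBasis hb).basis_mem i)
  rwa [Pi.neg_apply, show (0 + δ i + k + -δ i) = k by abel] at h2

/-- The dual of a tower splitting, over the base change of the dual complex. -/
noncomputable def towerOverDual (hS : GridDatum.IsGradedAlgebra (G := G) 𝒜)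
    (T : C.TowerOver 𝒜 n) :
    TowerSplitting 𝒜 (tensorGrading (A := G.S) 𝒜 (dualGrading G.gr C.gr))
      (C.sign.dualMap.baseChange R) ((C.d ∘ₗ C.sign).dualMap.baseChange R) (-n) :=
  have h1 : ∀ y, C.sign.baseChange R (C.sign.baseChange R y) = y := fun y => by
    rw [← LinearMap.comp_apply, ← LinearMap.baseChange_comp,
      show C.sign ∘ₗ C.sign = LinearMap.id from LinearMap.ext C.sign_sign,
      LinearMap.baseChange_id]
    rfl
  have h2 : ∀ y, C.sign.baseChange R (C.d.baseChange R y) =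
      -C.d.baseChange R (C.sign.baseChange R y) := fun y => by
    rw [← LinearMap.comp_apply, ← LinearMap.baseChange_comp,
      show C.sign ∘ₗ C.d = -(C.d ∘ₗ C.sign) from LinearMap.ext C.sign_d,
      LinearMap.baseChange_neg, LinearMap.baseChange_comp]
    rfl
  (T.dual h1 h2).congr (dualBaseChange R C).symm
    (fun y => by
      rw [LinearEquiv.symm_apply_eq, dualBaseChange_dualMap, LinearEquiv.apply_symm_apply])
    (fun y => by
      rw [LinearEquiv.symm_apply_eq, dualBaseChange_dualMap, LinearEquiv.apply_symm_apply,
        LinearMap.baseChange_comp])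
    (fun _ _ hy => dualBaseChange_symm_mem hy) (fun _ _ hy => dualBaseChange_mem hS hy)

/-- The dual of a tower splitting. -/
noncomputable def TowerOver.dual (hS : GridDatum.IsGradedAlgebra (G := G) 𝒜)
    (T : C.TowerOver 𝒜 n) : (dual C).TowerOver 𝒜 (-n) :=
  (towerOverDual hS T).ofEq (congrArg (LinearMap.baseChange R) (sign_dual C).symm)

end

theorem isKnotlike_dual {C : SComplex G} (hC : C.IsKnotlike) : (dual C).IsKnotlike where
  reduced := isReduced_dual hC.reduced
  left := by
    obtain ⟨j, ⟨T⟩⟩ := isLeftKnotlike_iff.1 hC.left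
    exact isLeftKnotlike_iff.2 ⟨-j, ⟨T.dual GridDatum.isGradedAlgebra_grU⟩⟩
  right := by
    obtain ⟨j, ⟨T⟩⟩ := isRightKnotlike_iff.1 hC.right
    exact isRightKnotlike_iff.2 ⟨-j, ⟨T.dual GridDatum.isGradedAlgebra_grV⟩⟩

end SComplex

namespace SComplex

variable {G : GridDatum.{u}}

/-! ### Evaluation and coevaluation -/

theorem tensorD_dual (C : SComplex G) : tensorD (dual C) C =
    (TensorProduct.map (C.d ∘ₗ C.sign).dualMap LinearMap.id +
      TensorProduct.map C.sign.dualMap C.d :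
      Module.Dual G.S C.carrier ⊗[G.S] C.carrier →ₗ[G.S] _) := by
  rw [tensorD, sign_dual]
  rfl

/-- On `φ ⊗ c` the two terms are `φ (d σ c)` and `φ (σ d c)`, which cancel. -/
theorem contractLeft_comp_differential {A M : Type u} [CommRing A] [AddCommGroup M] [Module A M]
    {d σ : M →ₗ[A] M} (h : ∀ y, σ (d y) = -d (σ y)) :
    contractLeft A M ∘ₗ (TensorProduct.map (d ∘ₗ σ).dualMap LinearMap.id +
      TensorProduct.map σ.dualMap d) = 0 := by
  refine TensorProduct.ext' fun φ c => ?_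
  simp [h]

/-- Under the identification with endomorphisms the coevaluation element is `σ`, and its
differential is `σ d σ + d = -d σ σ + d = 0`. -/
theorem differential_coevaluation {ι A M : Type*} [CommRing A] [AddCommGroup M] [Module A M]
    [Fintype ι] [DecidableEq ι] (b : Module.Basis ι A M) {d σ : M →ₗ[A] M}
    (hσ : ∀ y, σ (σ y) = y) (h : ∀ y, σ (d y) = -d (σ y)) :
    (TensorProduct.map (d ∘ₗ σ).dualMap LinearMap.id + TensorProduct.map σ.dualMap d :
      Module.Dual A M ⊗[A] M →ₗ[A] Module.Dual A M ⊗[A] M)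
      (∑ i, σ.dualMap (b.dualBasis i) ⊗ₜ[A] b i) = 0 := by
  apply (dualTensorHomEquivOfBasis b).injective
  rw [map_zero]
  refine LinearMap.ext fun y => ?_
  have h1 : ∀ z, ∑ i, b.repr z i • d (b i) = d z := fun z => by
    conv_rhs => rw [← b.sum_repr z]
    simp only [map_sum, map_smul]
  simp [Finset.sum_add_distrib, h, hσ, h1, b.sum_repr]

theorem contractLeft_baseChange {R : Type u} [CommRing R] [Algebra G.S R] (C : SComplex G)
    (t : R ⊗[G.S] Module.Dual G.S C.carrier) (y : R ⊗[G.S] C.carrier) :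
    TensorProduct.AlgebraTensorModule.rid G.S R R ((contractLeft G.S C.carrier).baseChange R
      ((TensorProduct.AlgebraTensorModule.distribBaseChange G.S R
        (Module.Dual G.S C.carrier) C.carrier).symm (t ⊗ₜ y))) = dualBaseChange R C t y := by
  induction t using TensorProduct.induction_on with
  | zero =>
    rw [TensorProduct.zero_tmul, LinearEquiv.map_zero, LinearMap.map_zero, LinearEquiv.map_zero,
      LinearEquiv.map_zero, LinearMap.zero_apply]
  | tmul r φ =>
    induction y using TensorProduct.induction_on with
    | zero =>
      rw [TensorProduct.tmul_zero, LinearEquiv.map_zero, LinearMap.map_zero, LinearEquiv.map_zero,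
        LinearMap.map_zero]
    | tmul s c =>
      rw [TensorProduct.AlgebraTensorModule.distribBaseChange_symm_tmul,
        LinearMap.baseChange_tmul, dualBaseChange_tmul_tmul,
        TensorProduct.AlgebraTensorModule.rid_tmul, contractLeft_apply, Algebra.smul_def]
      ring
    | add y z hy hz =>
      rw [TensorProduct.tmul_add, LinearEquiv.map_add, LinearMap.map_add, LinearEquiv.map_add, hy,
        hz, LinearMap.map_add]
  | add t t' ht ht' =>
    rw [TensorProduct.add_tmul, LinearEquiv.map_add, LinearMap.map_add, LinearEquiv.map_add, ht,
      ht', LinearEquiv.map_add, LinearMap.add_apply]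

/-- The map is evaluation. The tower of the dual is generated by `p` itself, so the product
generator `p ⊗ x` is sent to `p x = 1`. -/
theorem localLE_dual_tensor_trivial {C : SComplex G} (hC : C.IsKnotlike) :
    LocalLE (tensor (dual C) C) (trivial G) := by
  have _ := G.typeZeroV.isDomain
  obtain ⟨j, ⟨T⟩⟩ := isRightKnotlike_iff.1 hC.right
  have hchain' : contractLeft G.S C.carrier ∘ₗ tensorD (dual C) C = 0 :=
    (congrArg _ (tensorD_dual C)).trans (contractLeft_comp_differential C.sign_d)
  have hchain : contractLeft G.S C.carrier ∘ₗ (tensor (dual C) C).d =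
      (trivial G).d ∘ₗ contractLeft G.S C.carrier := hchain'.trans (LinearMap.zero_comp _).symm
  refine ⟨contractLeft G.S C.carrier, hchain, ⟨0, fun n t ht => ?_⟩, ?_⟩
  · rw [← Prod.zero_eq_mk, add_zero]
    refine map_mem_of_tensorGrading (P := dualGrading G.gr C.gr) (Q := C.gr)
      (contractLeft G.S C.carrier).toAddMonoidHom ?_ ht
    rintro p q φ c hφ hc rfl
    change φ c ∈ G.gr (p + q)
    rw [add_comm]
    exact hφ _ _ hc
  · refine (isLocalMap_iff_isUnit ((T.dual GridDatum.isGradedAlgebra_grV).tensor T)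
      (towerOverTrivial GridDatum.isGradedAlgebra_grV) hchain).2 ?_
    have h := contractLeft_baseChange C ((dualBaseChange G.RV C).symm T.p) T.x
    rw [LinearEquiv.apply_symm_apply, T.p_x] at h
    exact (congrArg IsUnit h).mpr isUnit_one

/-- The last clause computes the coordinate of the coevaluation along a tower: testing with
evaluation at `x` in one factor and `p` in the other gives `p (σ x)`, which is 1 for a tower
splitting. -/
theorem exists_coevaluation (C : SComplex G) :
    ∃ t : Module.Dual G.S C.carrier ⊗[G.S] C.carrier,
      t ∈ tensorGrading (A := G.S) (dualGrading G.gr C.gr) C.gr 0 ∧ tensorD (dual C) C t = 0 ∧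
      ∀ {R : Type u} [CommRing R] [Algebra G.S R] (x : R ⊗[G.S] C.carrier)
        (p : R ⊗[G.S] C.carrier →ₗ[R] R),
        (LinearMap.mul' R R ∘ₗ TensorProduct.map
          (Module.Dual.eval R _ x ∘ₗ (dualBaseChange R C).toLinearMap) p)
          (TensorProduct.AlgebraTensorModule.distribBaseChange G.S R
            (Module.Dual G.S C.carrier) C.carrier (1 ⊗ₜ t)) = p (C.sign.baseChange R x) := by
  obtain ⟨r, b, δ, hb⟩ := C.exists_isGradedBasis
  refine ⟨∑ i, C.sign.dualMap (b.dualBasis i) ⊗ₜ b i, ?_, ?_, ?_⟩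
  · refine sum_mem fun i _ => ?_
    have h1 : C.sign.dualMap (b.dualBasis i) ∈ dualGrading G.gr C.gr (-δ i) := fun m y hy =>
      (isGradedBasis_dualBasis hb).basis_mem i m _ (C.sign_mem hy)
    have h2 := tmul_mem_tensorGrading (A := G.S) h1 (hb.basis_mem i)
    rwa [neg_add_cancel] at h2
  · exact (LinearMap.congr_fun (tensorD_dual C) _).trans
      (differential_coevaluation b C.sign_sign C.sign_d)
  · intro R _ _ x p
    have key : ∑ i, dualBaseChange R C (1 ⊗ₜ C.sign.dualMap (b.dualBasis i)) x •
        ((1 : R) ⊗ₜ[G.S] b i) = C.sign.baseChange R x := by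
      induction x using TensorProduct.induction_on with
      | zero => simp only [map_zero, zero_smul, Finset.sum_const_zero]
      | tmul s c =>
        rw [LinearMap.baseChange_tmul]
        conv_rhs => rw [← b.sum_repr (C.sign c), TensorProduct.tmul_sum]
        refine Finset.sum_congr rfl fun i _ => ?_
        rw [dualBaseChange_tmul_tmul, one_mul, LinearMap.dualMap_apply, Module.Basis.dualBasis_apply,
          TensorProduct.tmul_smul, TensorProduct.smul_tmul', TensorProduct.smul_tmul', smul_eq_mul,
          mul_one, mul_comm, Algebra.smul_def]
      | add y z hy hz => simp only [map_add, add_smul, Finset.sum_add_distrib, hy, hz]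
    rw [← key, TensorProduct.tmul_sum]
    simp only [map_sum, map_smul, smul_eq_mul]
    refine Finset.sum_congr rfl fun i _ => ?_
    rfl

theorem localLE_trivial_dual_tensor {C : SComplex G} (hC : C.IsKnotlike) :
    LocalLE (trivial G) (tensor (dual C) C) := by
  have _ := G.typeZeroV.isDomain
  obtain ⟨j, ⟨T⟩⟩ := isRightKnotlike_iff.1 hC.right
  obtain ⟨t, ht, hdt, hp⟩ := exists_coevaluation C
  let F : G.S →ₗ[G.S] Module.Dual G.S C.carrier ⊗[G.S] C.carrier := LinearMap.toSpanSingleton _ _ t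
  have hchain : F ∘ₗ (trivial G).d = (tensor (dual C) C).d ∘ₗ F := by
    refine (LinearMap.comp_zero F).trans (LinearMap.ext fun (s : G.S) => ?_)
    change 0 = tensorD (dual C) C (s • t)
    exact ((LinearMap.map_smul _ _ _).trans ((congrArg (s • ·) hdt).trans (smul_zero s))).symm
  refine ⟨F, hchain, ⟨0, fun n s hs => ?_⟩, ?_⟩
  · exact (tensor (dual C) C).smul_mem (m := n) hs ht
  · refine (isLocalMap_iff_isUnit (towerOverTrivial GridDatum.isGradedAlgebra_grV)
      ((T.dual GridDatum.isGradedAlgebra_grV).tensor T) hchain).2 ?_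
    have h := hp (R := G.RV) T.x T.p
    rw [T.sign_x, T.p_x] at h
    have h1 : F.baseChange G.RV ((1 : G.RV) ⊗ₜ[G.S] (1 : G.S)) = 1 ⊗ₜ t := by
      rw [LinearMap.baseChange_tmul, LinearMap.toSpanSingleton_apply, one_smul]
    rw [← h1] at h
    exact (congrArg IsUnit h).mpr isUnit_one

end SComplex

/-! ### Residues of homogeneous elements -/

section Residue

variable {ι K : Type*} {R M : Type u} [Field K] [CommRing R] [AddCommGroup M] [Module R M]
  [Fintype ι] {𝒜 : ℤ × ℤ → AddSubgroup R} [GradedRing 𝒜] {P : ℤ × ℤ → AddSubgroup M}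
  {b : Module.Basis ι R M} {δ : ι → ℤ × ℤ} {f : R →+* K}

/-- The degree-`n` elements of `W`, reduced modulo the kernel of `f`. -/
def gradedResidue (hP : IsGradedBasis 𝒜 P b δ) (hf : ∀ k, ∃ r ∈ 𝒜 0, f r = k)
    (W : Submodule R M) (n : ℤ × ℤ) : Submodule K (ι → K) where
  carrier := {v | ∃ z ∈ W, z ∈ P n ∧ ∀ i, f (b.repr z i) = v i}
  zero_mem' := ⟨0, zero_mem _, zero_mem _, fun i => by simp⟩
  add_mem' := by
    rintro v w ⟨y, hy, hy', hv⟩ ⟨z, hz, hz', hw⟩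
    exact ⟨y + z, add_mem hy hz, add_mem hy' hz', fun i => by simp [hv, hw]⟩
  smul_mem' := by
    rintro k v ⟨z, hz, hz', hv⟩
    obtain ⟨r, hr, rfl⟩ := hf k
    exact ⟨r • z, W.smul_mem r hz, by simpa using hP.smul_mem hr hz', fun i => by simp [hv]⟩

/-- A functional on the reduction lifts to a homogeneous functional. -/
theorem exists_lift_functional (hP : IsGradedBasis 𝒜 P b δ) (hf : ∀ k, ∃ r ∈ 𝒜 0, f r = k)
    (n : ℤ × ℤ) {κ : ι → K} (hκ : ∀ i, δ i ≠ n → κ i = 0) : ∃ φ : M →ₗ[R] R,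
      (∀ m y, y ∈ P m → φ y ∈ 𝒜 (m - n)) ∧ ∀ z, f (φ z) = ∑ i, f (b.repr z i) * κ i := by
  have hk : ∀ i, ∃ r ∈ 𝒜 (δ i - n), f r = κ i := fun i => by
    by_cases h : δ i = n
    · rw [h, sub_self]; exact hf _
    · exact ⟨0, zero_mem _, by rw [map_zero, hκ i h]⟩
  choose k hk hkf using hk
  refine ⟨b.constr R k, fun m y hy => ?_, fun z => ?_⟩
  · rw [sub_eq_add_neg]
    refine hP.apply_mem_of_basis (fun i => ?_) hy
    rw [Module.Basis.constr_basis, ← sub_eq_add_neg]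
    exact hk i
  · rw [Module.Basis.constr_apply_fintype, map_sum]
    simp [hkf]

end Residue

namespace GridDatum

variable {G : GridDatum.{u}}

theorem fU_of_mem {n : ℤ × ℤ} {r : G.RU} (hr : r ∈ G.grU n) (hn : n ≠ 0) : G.fU r = 0 := by
  rw [fU_eq_zero_iff, DirectSum.decompose_of_mem_ne _ hr hn]

theorem fV_of_mem {n : ℤ × ℤ} {r : G.RV} (hr : r ∈ G.grV n) (hn : n ≠ 0) : G.fV r = 0 := by
  rw [fV_eq_zero_iff, DirectSum.decompose_of_mem_ne _ hr hn]

theorem exists_fU_eq (k : G.K) : ∃ r ∈ G.grU 0, G.fU r = k := by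
  obtain ⟨r, rfl⟩ := G.fU_surjective k
  exact ⟨_, SetLike.coe_mem _, by rw [fU_component, if_pos rfl]⟩

theorem exists_fV_eq (k : G.K) : ∃ r ∈ G.grV 0, G.fV r = k := by
  obtain ⟨r, rfl⟩ := G.fV_surjective k
  exact ⟨_, SetLike.coe_mem _, by rw [fV_component, if_pos rfl]⟩

end GridDatum

namespace SComplex

variable {G : GridDatum.{u}} {C : SComplex G}

/-! ### Comparison with the trivial complex -/

theorem repr_one_tmul {R : Type u} [CommRing R] [Algebra G.S R] {r : ℕ}
    (b : Module.Basis (Fin r) G.S C.carrier) (c : C.carrier) (i : Fin r) :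
    (b.baseChange R).repr (1 ⊗ₜ c) i = algebraMap G.S R (b.repr c i) := by
  simp [Algebra.algebraMap_eq_smul_one]

theorem one_tmul_mem {R : Type u} [CommRing R] [Algebra G.S R] {𝒜 : ℤ × ℤ → AddSubgroup R}
    [GradedRing 𝒜] {n : ℤ × ℤ} {c : C.carrier} (hc : c ∈ C.gr n) :
    (1 : R) ⊗ₜ[G.S] c ∈ tensorGrading (A := G.S) 𝒜 C.gr n := by
  have := tmul_mem_tensorGrading (A := G.S) (SetLike.GradedOne.one_mem (A := 𝒜)) hc
  rwa [zero_add] at this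

/-- Elements of the two base changes with the same reduction glue to an element of the
complex. -/
theorem exists_glue {r : ℕ} (b : Module.Basis (Fin r) G.S C.carrier)
    (z : G.RU ⊗[G.S] C.carrier) (y : G.RV ⊗[G.S] C.carrier)
    (h : ∀ i, G.fU ((b.baseChange G.RU).repr z i) = G.fV ((b.baseChange G.RV).repr y i)) :
    ∃ c : C.carrier, (1 : G.RU) ⊗ₜ[G.S] c = z ∧ (1 : G.RV) ⊗ₜ[G.S] c = y := by
  let s : Fin r → G.S := fun i =>
    ⟨((b.baseChange G.RU).repr z i, (b.baseChange G.RV).repr y i), h i⟩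
  refine ⟨∑ i, s i • b i, ?_, ?_⟩
  · apply (b.baseChange G.RU).repr.injective
    ext i
    rw [repr_one_tmul, b.repr_sum_self]
    rfl
  · apply (b.baseChange G.RV).repr.injective
    ext i
    rw [repr_one_tmul, b.repr_sum_self]
    rfl

theorem mem_gr_of_one_tmul_mem {n : ℤ × ℤ} {c : C.carrier}
    (hU : (1 : G.RU) ⊗ₜ[G.S] c ∈ tensorGrading (A := G.S) G.grU C.gr n)
    (hV : (1 : G.RV) ⊗ₜ[G.S] c ∈ tensorGrading (A := G.S) G.grV C.gr n) : c ∈ C.gr n := by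
  obtain ⟨r, b, δ, hb⟩ := C.exists_isGradedBasis
  rw [hb]
  intro i
  have h1 := (C.isGradedBasis_baseChange GridDatum.isGradedAlgebra_grU hb n _).1 hU i
  have h2 := (C.isGradedBasis_baseChange GridDatum.isGradedAlgebra_grV hb n _).1 hV i
  rw [repr_one_tmul] at h1 h2
  exact ⟨h1, h2⟩

/-- `S` embeds in `RU × RV` and `C` is free, so equations in `C` can be checked over the two base
changes separately. -/
theorem eq_zero_of_one_tmul_eq_zero {c : C.carrier} (hU : (1 : G.RU) ⊗ₜ[G.S] c = 0)
    (hV : (1 : G.RV) ⊗ₜ[G.S] c = 0) : c = 0 := by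
  obtain ⟨r, b, δ, hb⟩ := C.exists_isGradedBasis
  apply b.repr.injective
  ext i : 1
  have h1 := repr_one_tmul (R := G.RU) b c i
  have h2 := repr_one_tmul (R := G.RV) b c i
  rw [hU, map_zero] at h1
  rw [hV, map_zero] at h2
  rw [map_zero]
  exact GridDatum.S_ext (h1.symm.trans (map_zero _).symm) (h2.symm.trans (map_zero _).symm)

/-- Functionals on the two base changes with the same reduction glue to a functional on the
complex. -/
theorem exists_glue_functional {r : ℕ} (b : Module.Basis (Fin r) G.S C.carrier)
    (φ : G.RU ⊗[G.S] C.carrier →ₗ[G.RU] G.RU) (ψ : G.RV ⊗[G.S] C.carrier →ₗ[G.RV] G.RV)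
    (h : ∀ i, G.fU (φ (1 ⊗ₜ b i)) = G.fV (ψ (1 ⊗ₜ b i))) :
    ∃ F : C.carrier →ₗ[G.S] G.S, ∀ c, G.pU (F c) = φ (1 ⊗ₜ c) ∧ G.pV (F c) = ψ (1 ⊗ₜ c) := by
  let s : Fin r → G.S := fun i => ⟨(φ (1 ⊗ₜ b i), ψ (1 ⊗ₜ b i)), h i⟩
  refine ⟨b.constr G.S s, fun c => ?_⟩
  rw [Module.Basis.constr_apply_fintype, map_sum, map_sum]
  conv =>
    congr
    · rhs; rw [← (b.baseChange G.RU).sum_repr (1 ⊗ₜ c), map_sum]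
    · rhs; rw [← (b.baseChange G.RV).sum_repr (1 ⊗ₜ c), map_sum]
  constructor
  · refine Finset.sum_congr rfl fun i _ => ?_
    rw [repr_one_tmul, smul_eq_mul, map_mul, map_smul, smul_eq_mul, Module.Basis.baseChange_apply]
    rfl
  · refine Finset.sum_congr rfl fun i _ => ?_
    rw [repr_one_tmul, smul_eq_mul, map_mul, map_smul, smul_eq_mul, Module.Basis.baseChange_apply]
    rfl

/-- A homogeneous cycle generating the tower of `C ⊗ RV` gives a local map from the trivial
complex. -/
theorem localLE_trivial_of_cycle {j : ℤ} (T : C.TowerOver G.grV (0, j)) {c : C.carrier}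
    (hc : c ∈ C.gr (0, j)) (hdc : C.d c = 0) (hp : T.p (1 ⊗ₜ c) = 1) : LocalLE (trivial G) C := by
  have _ := G.typeZeroV.isDomain
  let F : G.S →ₗ[G.S] C.carrier := LinearMap.toSpanSingleton _ _ c
  have hchain : F ∘ₗ (trivial G).d = C.d ∘ₗ F := by
    refine (LinearMap.comp_zero F).trans (LinearMap.ext fun (s : G.S) => ?_)
    change 0 = C.d (s • c)
    rw [map_smul, hdc, smul_zero]
  refine ⟨F, hchain, ⟨j, fun n s hs => C.smul_mem (m := n) hs hc⟩, ?_⟩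
  refine (isLocalMap_iff_isUnit (towerOverTrivial GridDatum.isGradedAlgebra_grV) T hchain).2 ?_
  have h1 : F.baseChange G.RV ((1 : G.RV) ⊗ₜ[G.S] (1 : G.S)) = 1 ⊗ₜ c := by
    rw [LinearMap.baseChange_tmul, LinearMap.toSpanSingleton_apply, one_smul]
  rw [← h1] at hp
  exact (congrArg IsUnit hp).mpr isUnit_one

/-- A homogeneous cocycle restricting to an isomorphism on the tower of `C ⊗ RV` gives a local
map to the trivial complex. -/
theorem localLE_trivial_of_cocycle {j : ℤ} (T : C.TowerOver G.grV (0, j))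
    {F : C.carrier →ₗ[G.S] G.S} (hF : ∀ n c, c ∈ C.gr n → F c ∈ G.gr (n - (0, j)))
    (hFd : ∀ c, F (C.d c) = 0) {ψ : G.RV ⊗[G.S] C.carrier →ₗ[G.RV] G.RV}
    (hψ : ∀ c, G.pV (F c) = ψ (1 ⊗ₜ c)) (hx : ψ T.x = 1) : LocalLE C (trivial G) := by
  have _ := G.typeZeroV.isDomain
  have hchain : F ∘ₗ C.d = (trivial G).d ∘ₗ F :=
    (LinearMap.ext hFd : F ∘ₗ C.d = 0).trans (LinearMap.zero_comp _).symm
  refine ⟨F, hchain, ⟨-j, fun n c hc => ?_⟩, ?_⟩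
  · have h := hF n c hc
    rwa [sub_eq_add_neg, show -((0, j) : ℤ × ℤ) = (0, -j) from rfl] at h
  · refine (isLocalMap_iff_isUnit T (towerOverTrivial GridDatum.isGradedAlgebra_grV) hchain).2 ?_
    have h : ∀ y, TensorProduct.AlgebraTensorModule.rid G.S G.RV G.RV (F.baseChange G.RV y) =
        ψ y := by
      intro y
      induction y using TensorProduct.induction_on with
      | zero => rw [LinearMap.map_zero, LinearEquiv.map_zero, LinearMap.map_zero]
      | tmul s c =>
        have hs : s ⊗ₜ[G.S] c = s • (1 : G.RV) ⊗ₜ[G.S] c := by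
          rw [TensorProduct.smul_tmul', smul_eq_mul, mul_one]
        rw [LinearMap.baseChange_tmul, TensorProduct.AlgebraTensorModule.rid_tmul, hs, map_smul,
          ← hψ, Algebra.smul_def, smul_eq_mul, mul_comm]
        rfl
      | add y z hy hz =>
        rw [LinearMap.map_add, LinearEquiv.map_add, hy, hz, LinearMap.map_add]
    exact (congrArg IsUnit ((h T.x).trans hx)).mpr isUnit_one

/-- For a knotlike complex `C` there is a local map from the trivial complex to `C` or from `C`
to the trivial complex. -/
theorem localLE_trivial_or (hC : C.IsRightKnotlike) :
    LocalLE (trivial G) C ∨ LocalLE C (trivial G) := by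
  obtain ⟨j, ⟨T⟩⟩ := isRightKnotlike_iff.1 hC
  obtain ⟨r, b, δ, hb⟩ := C.exists_isGradedBasis
  have hU := C.isGradedBasis_baseChange GridDatum.isGradedAlgebra_grU hb
  have hV := C.isGradedBasis_baseChange GridDatum.isGradedAlgebra_grV hb
  let dU := C.d.baseChange G.RU
  let dV := C.d.baseChange G.RV
  obtain ⟨qU, hdqU, hqU, hqU'⟩ := exists_projection
    G.typeZeroU.toIsGradedValuationRing hU hU (d := dU) (w := -(1, 1)) fun i => by
      rw [← sub_eq_add_neg]; exact C.baseChange_d_mem (hU.basis_mem i)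
  obtain ⟨qV, hdqV, hqV, hqV'⟩ := exists_projection
    G.typeZeroV.toIsGradedValuationRing hV hV (d := dV) (w := -(1, 1)) fun i => by
      rw [← sub_eq_add_neg]; exact C.baseChange_d_mem (hV.basis_mem i)
  let n : ℤ × ℤ := (0, j)
  -- Over `RU` any cycle may be used, as only the tower over `RV` matters for locality. Over `RV`
  -- the generator `x` may be altered only by cycles in `ker p`, so as to keep `p = 1`.
  let LU : Submodule G.K (Fin r → G.K) :=
    gradedResidue hU GridDatum.exists_fU_eq (LinearMap.ker dU) n
  let LV : Submodule G.K (Fin r → G.K) :=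
    gradedResidue hV GridDatum.exists_fV_eq (LinearMap.ker dV ⊓ LinearMap.ker T.p) n
  let v : Fin r → G.K := fun i => G.fV ((b.baseChange G.RV).repr T.x i)
  by_cases hv : v ∈ LU ⊔ LV
  · left
    obtain ⟨_, ⟨z, hz, hzn, hz'⟩, w, ⟨y, hy, hyn, hy'⟩, hvw⟩ := Submodule.mem_sup.1 hv
    -- From `v = z̄ + ȳ`, the cycles `z` over `RU` and `x - y` over `RV` have the same reduction.
    obtain ⟨c, hcU, hcV⟩ := exists_glue b z (T.x - y) fun i => by
      rw [hz', map_sub, Finsupp.sub_apply, map_sub, hy', eq_sub_iff_add_eq]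
      exact congrFun hvw i
    refine localLE_trivial_of_cycle T (c := c) ?_ ?_ ?_
    · refine mem_gr_of_one_tmul_mem ?_ ?_
      · rw [hcU]; exact hzn
      · rw [hcV]; exact sub_mem T.x_mem hyn
    · refine eq_zero_of_one_tmul_eq_zero ?_ ?_
      · rw [← LinearMap.baseChange_tmul, hcU]; exact hz
      · rw [← LinearMap.baseChange_tmul, hcV, map_sub, T.d_x, zero_sub, neg_eq_zero]
        exact hy.1
    · rw [hcV, map_sub, T.p_x, LinearMap.mem_ker.1 hy.2, sub_zero]
  · right
    obtain ⟨f, hfv, hfL⟩ := Submodule.exists_le_ker_of_notMem hv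
    -- The separating functional, normalised to be 1 at `v` and truncated to the coordinates of
    -- degree `n`; these are the only coordinates where reductions of degree-`n` elements can be
    -- nonzero.
    let κ : Fin r → G.K := fun i => if δ i = n then f (Pi.single i 1) / f v else 0
    have hκ : ∀ i, δ i ≠ n → κ i = 0 := fun i hi => if_neg hi
    have hf : ∀ u : Fin r → G.K, (∀ i, δ i ≠ n → u i = 0) → ∑ i, u i * κ i = f u / f v := by
      intro u hu
      conv_rhs => rw [pi_eq_sum_univ' u, map_sum, Finset.sum_div]
      refine Finset.sum_congr rfl fun i _ => ?_
      by_cases h : δ i = n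
      · simp only [κ, h, if_true, map_smul, smul_eq_mul, mul_div_assoc]
      · simp [hu i h]
    obtain ⟨φ, hφ, hφ'⟩ := exists_lift_functional hU GridDatum.exists_fU_eq n hκ
    obtain ⟨ψ, hψ, hψ'⟩ := exists_lift_functional hV GridDatum.exists_fV_eq n hκ
    have hdeg : ∀ {m : ℤ × ℤ}, m ≠ n → m - n ≠ 0 := fun h => sub_ne_zero.2 h
    -- Modulo the maximal ideal `φ` kills homogeneous cycles: in degree `n` because `f` kills `LU`,
    -- in other degrees because the value has nonzero degree.
    have hφ0 : ∀ m z, z ∈ tensorGrading (A := G.S) G.grU C.gr m → dU z = 0 →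
        G.fU (φ z) = 0 := by
      intro m z hz hdz
      by_cases h : m = n
      · subst h
        have hmem : (fun i => G.fU ((b.baseChange G.RU).repr z i)) ∈ LU :=
          ⟨z, hdz, hz, fun _ => rfl⟩
        rw [hφ', hf (fun i => G.fU ((b.baseChange G.RU).repr z i)),
          LinearMap.mem_ker.1 (hfL (Submodule.mem_sup_left hmem)), zero_div]
        exact fun i hi => GridDatum.fU_of_mem ((hU _ _).1 hz i) (sub_ne_zero.2 (Ne.symm hi))
      · exact GridDatum.fU_of_mem (hφ m z hz) (hdeg h)
    have hψx : G.fV (ψ T.x) = 1 := by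
      rw [hψ', hf v]
      · exact div_self hfv
      · exact fun i hi => GridDatum.fV_of_mem ((hV _ _).1 T.x_mem i) (sub_ne_zero.2 (Ne.symm hi))
    have hψ0 : ∀ m z, z ∈ tensorGrading (A := G.S) G.grV C.gr m → dV z = 0 →
        G.fV (ψ z) = G.fV (T.p z) := by
      intro m z hz hdz
      by_cases h : m = n
      · subst h
        have hpz := T.p_mem hz
        rw [sub_self] at hpz
        -- Subtracting `p z • x` moves the cycle into `ker p`, where its reduction lies in `LV` and
        -- is killed by `f`.
        have hy : z - T.p z • T.x ∈ tensorGrading (A := G.S) G.grV C.gr n := by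
          have := hV.smul_mem hpz T.x_mem
          rw [zero_add] at this
          exact sub_mem hz this
        have hmem : (fun i => G.fV ((b.baseChange G.RV).repr (z - T.p z • T.x) i)) ∈ LV := by
          refine ⟨_, ⟨?_, ?_⟩, hy, fun _ => rfl⟩
          · rw [SetLike.mem_coe, LinearMap.mem_ker, map_sub, map_smul, hdz]
            change 0 - T.p z • C.d.baseChange G.RV T.x = 0
            rw [T.d_x, smul_zero, sub_zero]
          · rw [SetLike.mem_coe, LinearMap.mem_ker, map_sub, map_smul, T.p_x, smul_eq_mul, mul_one,
              sub_self]
        have h0 : G.fV (ψ (z - T.p z • T.x)) = 0 := by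
          rw [hψ', hf (fun i => G.fV ((b.baseChange G.RV).repr (z - T.p z • T.x) i)),
            LinearMap.mem_ker.1 (hfL (Submodule.mem_sup_right hmem)), zero_div]
          exact fun i hi => GridDatum.fV_of_mem ((hV _ _).1 hy i) (sub_ne_zero.2 (Ne.symm hi))
        rw [map_sub, map_sub, map_smul, smul_eq_mul, map_mul, hψx, mul_one, sub_eq_zero] at h0
        exact h0
      · rw [GridDatum.fV_of_mem (hψ m z hz) (hdeg h),
          GridDatum.fV_of_mem (T.p_mem hz) (hdeg h)]
    have hb1 : ∀ i, (1 : G.RU) ⊗ₜ[G.S] b i ∈ tensorGrading (A := G.S) G.grU C.gr (δ i) :=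
      fun i => one_tmul_mem (hb.basis_mem i)
    have hb2 : ∀ i, (1 : G.RV) ⊗ₜ[G.S] b i ∈ tensorGrading (A := G.S) G.grV C.gr (δ i) :=
      fun i => one_tmul_mem (hb.basis_mem i)
    -- Corrections making both functionals exact cocycles: on cycles `Φ` is zero and `Ψ` is `p`, so
    -- both vanish on boundaries. By `hφ0` and `hψ0` the corrections do not change the reductions on
    -- homogeneous elements, so gluing remains possible.
    let Φ := φ ∘ₗ qU
    let Ψ := ψ ∘ₗ qV + T.p ∘ₗ (LinearMap.id - qV)
    obtain ⟨F, hF⟩ := exists_glue_functional b Φ Ψ fun i => by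
      have h1 := hφ0 (δ i) (1 ⊗ₜ b i - qU (1 ⊗ₜ b i)) (sub_mem (hb1 i) (hqU' _ _ (hb1 i)))
        (by rw [map_sub, hdqU, sub_self])
      have h2 := hψ0 (δ i) (1 ⊗ₜ b i - qV (1 ⊗ₜ b i)) (sub_mem (hb2 i) (hqV' _ _ (hb2 i)))
        (by rw [map_sub, hdqV, sub_self])
      -- Both lifts reduce to the same `κ`, and the coordinates of `b i` over `RU` and `RV` come
      -- from the same elements of `S`.
      have h3 : G.fU (φ (1 ⊗ₜ b i)) = G.fV (ψ (1 ⊗ₜ b i)) := by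
        rw [hφ', hψ']
        refine Finset.sum_congr rfl fun k _ => ?_
        rw [repr_one_tmul, repr_one_tmul]
        exact congrArg (· * κ k) (GridDatum.fU_pU (b.repr (b i) k))
      change G.fU (φ (qU (1 ⊗ₜ b i))) =
        G.fV (ψ (qV (1 ⊗ₜ b i)) + T.p (1 ⊗ₜ b i - qV (1 ⊗ₜ b i)))
      rw [map_add, ← h2, ← map_add, ← map_add, add_sub_cancel, ← h3]
      rw [map_sub, map_sub, sub_eq_zero] at h1
      exact h1.symm
    refine localLE_trivial_of_cocycle T (F := F) (ψ := Ψ) (fun m c hc => ?_) (fun c => ?_)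
      (fun c => (hF c).2) ?_
    · rw [GridDatum.mem_gr, (hF c).1, (hF c).2]
      exact ⟨hφ _ _ (hqU' _ _ (one_tmul_mem hc)), add_mem (hψ _ _ (hqV' _ _ (one_tmul_mem hc)))
        (T.p_mem (sub_mem (one_tmul_mem hc) (hqV' _ _ (one_tmul_mem hc))))⟩
    · refine GridDatum.S_ext ?_ ?_
      · rw [(hF _).1, map_zero, ← LinearMap.baseChange_tmul]
        change φ (qU (dU (1 ⊗ₜ c))) = 0
        rw [hqU _ (C.baseChange_d_d _), map_zero]
      · rw [(hF _).2, map_zero, ← LinearMap.baseChange_tmul]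
        change ψ (qV (dV (1 ⊗ₜ c))) + T.p (dV (1 ⊗ₜ c) - qV (dV (1 ⊗ₜ c))) = 0
        rw [hqV _ (C.baseChange_d_d _), map_zero, sub_zero, zero_add]
        exact T.p_d _
    · change ψ (qV T.x) + T.p (T.x - qV T.x) = 1
      rw [hqV _ T.d_x, map_zero, sub_zero, zero_add, T.p_x]

end SComplex

/-! ### The group of local equivalence classes -/

theorem SComplex.LocalLE.trans {G : GridDatum.{u}} {C D E : SComplex G} :
    LocalLE C D → LocalLE D E → LocalLE C E :=
  fun ⟨_, hf⟩ ⟨_, hg⟩ => ⟨_, hg.comp hf⟩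

namespace LocalClasses

variable {G : GridDatum.{u}}

/-- The product of two knotlike complexes. -/
noncomputable def tensor (C D : KnotlikeComplex G) : KnotlikeComplex G :=
  ⟨SComplex.tensor C.1 D.1, SComplex.isKnotlike_tensor C.2 D.2⟩

theorem tensor_le_tensor {C C' D D' : KnotlikeComplex G} (h : C ≤ C') (h' : D ≤ D') :
    tensor C D ≤ tensor C' D' :=
  SComplex.LocalLE.tensor C.2 D.2 C'.2 D'.2 h h'

theorem localClass_eq {C D : KnotlikeComplex G} (h : SComplex.LocalLE C.1 D.1)
    (h' : SComplex.LocalLE D.1 C.1) : localClass C = localClass D :=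
  Quotient.sound ⟨h, h'⟩

/-- The monoid of local equivalence classes. -/
@[reducible]
noncomputable def commMonoid : CommMonoid (LocalClasses G) where
  mul := Quotient.map₂ tensor fun _ _ h _ _ h' =>
    ⟨tensor_le_tensor h.1 h'.1, tensor_le_tensor h.2 h'.2⟩
  one := localClass ⟨SComplex.trivial G, SComplex.isKnotlike_trivial⟩
  mul_assoc a b c := by
    induction a using Quotient.inductionOn
    induction b using Quotient.inductionOn
    induction c using Quotient.inductionOn
    exact localClass_eq (SComplex.localLE_tensor_assoc _ _ _).1
      (SComplex.localLE_tensor_assoc _ _ _).2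
  one_mul a := by
    induction a using Quotient.inductionOn
    exact localClass_eq (SComplex.localLE_trivial_tensor _).1 (SComplex.localLE_trivial_tensor _).2
  mul_one a := by
    induction a using Quotient.inductionOn
    exact localClass_eq
      ((SComplex.localLE_tensor_comm _ _).trans (SComplex.localLE_trivial_tensor _).1)
      ((SComplex.localLE_trivial_tensor _).2.trans (SComplex.localLE_tensor_comm _ _))
  mul_comm a b := by
    induction a using Quotient.inductionOn
    induction b using Quotient.inductionOn
    exact localClass_eq (SComplex.localLE_tensor_comm _ _) (SComplex.localLE_tensor_comm _ _)

/-- The inverse is the class of the dual complex, by evaluation and coevaluation. -/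
theorem isUnit (a : LocalClasses G) : @IsUnit _ commMonoid.toMonoid a := by
  let _ := commMonoid (G := G)
  induction a using Quotient.inductionOn with
  | h C =>
    refine IsUnit.of_mul_eq_one_right
      (localClass ⟨SComplex.dual C.1, SComplex.isKnotlike_dual C.2⟩) ?_
    exact localClass_eq (SComplex.localLE_dual_tensor_trivial C.2)
      (SComplex.localLE_trivial_dual_tensor C.2)

/-- The group of local equivalence classes. -/
@[reducible]
noncomputable def commGroup : CommGroup (LocalClasses G) :=
  commGroupOfIsUnit (hM := commMonoid) isUnit

theorem isOrderedMonoid :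
    @IsOrderedMonoid (LocalClasses G) commGroup.toCommMonoid inferInstance :=
  letI := commGroup (G := G)
  { mul_le_mul_left := fun a b h c => by
      induction a using Quotient.inductionOn
      induction b using Quotient.inductionOn
      induction c using Quotient.inductionOn
      exact tensor_le_tensor h le_rfl }

theorem le_total (a b : LocalClasses G) : a ≤ b ∨ b ≤ a := by
  let _ := commGroup (G := G)
  have := isOrderedMonoid (G := G)
  have h : ∀ c : LocalClasses G, 1 ≤ c ∨ c ≤ 1 := fun c => by
    induction c using Quotient.inductionOn with
    | h C => exact SComplex.localLE_trivial_or C.2.right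
  -- Translation invariance reduces the comparison of `a` and `b` to that of `a⁻¹ * b` with the
  -- identity.
  simpa using h (a⁻¹ * b)

end LocalClasses

theorem mainTheorem1 (G : GridDatum.{u}) :
    -- the tensor product makes the set of local equivalence classes an abelian group, and the
    -- relation `≤` is a total order on it compatible with the group structure
    (∃ _ : CommGroup (LocalClasses G),
      (∀ C D : KnotlikeComplex G, ∃ h : (SComplex.tensor C.1 D.1).IsKnotlike,
        localClass C * localClass D = localClass ⟨SComplex.tensor C.1 D.1, h⟩) ∧
      (∃ h : (SComplex.trivial G).IsKnotlike,
        (1 : LocalClasses G) = localClass ⟨SComplex.trivial G, h⟩) ∧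
      (∀ C D : KnotlikeComplex G,
        localClass C ≤ localClass D ↔ SComplex.LocalLE C.1 D.1) ∧
      (∀ a b : LocalClasses G, a ≤ b → b ≤ a → a = b) ∧
      (∀ a b : LocalClasses G, a ≤ b ∨ b ≤ a) ∧
      IsOrderedMonoid (LocalClasses G)) ∧
    -- the key lemma
    (∀ C : KnotlikeComplex G, ¬ SComplex.LocalLE (SComplex.trivial G) C.1 →
      SComplex.LocalLE C.1 (SComplex.trivial G)) := by
  refine ⟨⟨LocalClasses.commGroup, fun C D => ⟨SComplex.isKnotlike_tensor C.2 D.2, rfl⟩,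
    ⟨SComplex.isKnotlike_trivial, rfl⟩, fun C D => Iff.rfl, fun a b => le_antisymm,
    LocalClasses.le_total, LocalClasses.isOrderedMonoid⟩, fun C hC => ?_⟩
  exact (SComplex.localLE_trivial_or C.2.right).resolve_left hC
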